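/- Let $X$ be an $n$-dimensional rigidified complex manifold: a Hausdorff, second countable space with an atlas of charts in $\mathbb{C}^n$ whose transition maps are rigid, i.e. of the form $(u_1,\dots,u_n)\mapsto(\phi^1(u_1),\dots,\phi^n(u_n))$ with each $\phi^j$ holomorphic in one variable. Let $\mathrm{d}s^2$ be a distinctive Kähler metric on $X$, i.e. a smooth hermitian metric such that every point $x\in X$ has a neighbourhood with coordinates $(z_1,\dots,z_n)$ compatible with the atlas and a unitary coframe $\varphi_j=f_j(z_j)\,\mathrm{d}z_j$ $(j=1,\dots,n)$, so that $\mathrm{d}s^2=\sum_j\varphi_j\otimes\overline{\varphi}_j$, with $\frac{\partial f_j}{\partial\overline{z}_j}=0$ at $x$. Let $\omega=\frac{i}{2}\sum_j\varphi_j\wedge\overline{\varphi}_j$ be the associated $(1,1)$-form. Let $A^m(X)$ be the space of smooth complex-valued $m$-forms on $X$. For $1\le j\le n$ let $\xi_j\colon A^m(X)\to A^{m+1}(X)$ be the $\mathrm{d}z_j$-component of $\partial$: the $\mathbb{C}$-linear operator given in every chart of the rigidified structure by $$\xi_j\big(f\,\mathrm{d}z_\alpha\wedge\mathrm{d}\overline{z}_\beta\big)=\frac{\partial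 f}{\partial z_j}\,\mathrm{d}z_j\wedge\mathrm{d}z_\alpha\wedge\mathrm{d}\overline{z}_\beta .$$ Let $\langle\psi,\eta\rangle=\int_X(\psi(x),\eta(x))\,\frac{\omega^n}{n!}$, where $(\cdot,\cdot)$ is the hermitian inner product on forms induced by the metric. Then: 1. For all $k\in\{1,\dots,n\}$ and $m\ge 0$, the operator $\xi_k\colon A^m(X)\to A^{m+1}(X)$ has a unique formal adjoint, i.e. there is a unique linear operator $\xi_k^\star\colon A^{m+1}(X)\to A^m(X)$ with $\langle\xi_k^\star\psi,\eta\rangle=\langle\psi,\xi_k\eta\rangle$ for all $\psi\in A^{m+1}(X)$ and all compactly supported $\eta\in A^m(X)$ (all $\eta\in A^m(X)$ if $X$ is compact). Put $\xi_k^\star=0$ on $A^0(X)$. 2. For all $j\neq k$, as operators on $A^m(X)$ for every $m\ge 0$, $$\xi_j\,\xi_k^\star+\xi_k^\star\,\xi_j=0 .$$ -/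

import Mathlib

open scoped ContDiff
open MeasureTheory

noncomputable section

namespace RigidKahler

/-- The model space `ℂⁿ`. -/
abbrev Cn (n : ℕ) : Type := Fin n → ℂ

/-! ### Rigidified complex manifolds -/

/-- A map `φ` is rigid on `U ⊆ ℂⁿ` if `φ(u₁, …, uₙ) = (φ¹(u₁), …, φⁿ(uₙ))` on `U`, where each
`φʲ` is a holomorphic function of one variable (on the projection of `U` to the `j`-th axis). -/
def IsRigid {n : ℕ} (φ : Cn n → Cn n) (U : Set (Cn n)) : Prop :=
  ∃ f : Fin n → ℂ → ℂ,
    (∀ j, DifferentiableOn ℂ (f j) ((fun u : Cn n => u j) '' U)) ∧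
      ∀ u ∈ U, ∀ j, φ u j = f j (u j)

/-- The transition map from the chart `e` to the chart `e'`. -/
abbrev transition {n : ℕ} {X : Type*} [TopologicalSpace X]
    (e e' : OpenPartialHomeomorph X (Cn n)) : OpenPartialHomeomorph (Cn n) (Cn n) :=
  e.symm.trans e'

/-- Two charts are compatible if the transition map and its inverse are both rigid. -/
def RigidCompatible {n : ℕ} {X : Type*} [TopologicalSpace X]
    (e e' : OpenPartialHomeomorph X (Cn n)) : Prop :=
  IsRigid (transition e e') (transition e e').source ∧
    IsRigid (transition e' e) (transition e' e).source

/-- The atlas of `X` (a covering of `X` by charts with values in `ℂⁿ`) is a rigidified atlas: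
its charts are pairwise compatible. -/
class IsRigidified (n : ℕ) (X : Type*) [TopologicalSpace X] [ChartedSpace (Cn n) X] : Prop where
  compatible : ∀ e ∈ atlas (Cn n) X, ∀ e' ∈ atlas (Cn n) X, RigidCompatible e e'

/-- The charts of the rigidified holomorphic structure defined by the atlas of `X`, i.e. all
charts which are compatible with every chart of the atlas. -/
abbrev RigidChart (n : ℕ) (X : Type*) [TopologicalSpace X] [ChartedSpace (Cn n) X] : Type _ :=
  {e : OpenPartialHomeomorph X (Cn n) // ∀ c ∈ atlas (Cn n) X, RigidCompatible e c}

/-- The preferred chart at `x`. -/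
def rigidChartAt (n : ℕ) {X : Type*} [TopologicalSpace X] [ChartedSpace (Cn n) X]
    [IsRigidified n X] (x : X) : RigidChart n X :=
  ⟨chartAt (Cn n) x, fun c hc =>
    IsRigidified.compatible _ (chart_mem_atlas (Cn n) x) c hc⟩

/-! ### Smooth complex valued differential forms -/

/-- Complex valued real-alternating `k`-forms on the real vector space underlying `ℂⁿ`. -/
abbrev Alt (n k : ℕ) : Type := Cn n [⋀^Fin k]→L[ℝ] ℂ

/-- The space of smooth complex valued `k`-forms on `X`. A form `ψ` is given by its local
expression `ψ e` on `e.target ⊆ ℂⁿ` in every chart `e` (extended by zero outside of `e.target`).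
The local expressions are smooth, and correspond to each other by pullback along the transition
maps. -/
def DiffForm (n : ℕ) (X : Type*) [TopologicalSpace X] [ChartedSpace (Cn n) X] (k : ℕ) :
    Submodule ℂ (RigidChart n X → Cn n → Alt n k) where
  carrier := {ψ |
    (∀ e, ContDiffOn ℝ ∞ (ψ e) e.1.target) ∧
    (∀ e e' : RigidChart n X, ∀ u ∈ (transition e.1 e'.1).source,
      ψ e u = (ψ e' (transition e.1 e'.1 u)).compContinuousLinearMap
        (fderiv ℝ (transition e.1 e'.1) u)) ∧
    ∀ e, ∀ u ∉ e.1.target, ψ e u = 0}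
  add_mem' := by
    rintro ψ η ⟨h1, h2, h3⟩ ⟨h1', h2', h3'⟩
    refine ⟨fun e => (h1 e).add (h1' e), fun e e' u hu => ?_, fun e u hu => ?_⟩
    · simp only [Pi.add_apply, h2 e e' u hu, h2' e e' u hu]
      rfl
    · simp [h3 e u hu, h3' e u hu]
  zero_mem' := ⟨fun e => contDiffOn_const, fun e e' u hu => rfl, fun e u hu => rfl⟩
  smul_mem' := by
    rintro c ψ ⟨h1, h2, h3⟩
    refine ⟨fun e => (h1 e).const_smul c, fun e e' u hu => ?_, fun e u hu => ?_⟩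
    · simp only [Pi.smul_apply, h2 e e' u hu]
      rfl
    · simp [h3 e u hu]

/-- The value of a form at a point of `X`, in the preferred chart at that point. -/
def valueAt {n : ℕ} {X : Type*} [TopologicalSpace X] [ChartedSpace (Cn n) X]
    [IsRigidified n X] {k : ℕ} (ψ : DiffForm n X k) (x : X) : Alt n k :=
  ψ.1 (rigidChartAt n x) ((rigidChartAt n x).1 x)

/-! ### The operators `ξ_j` in `ℂⁿ` -/

/-- The covector `dz_j`. -/
def dz {n : ℕ} (j : Fin n) : Cn n →L[ℝ] ℂ := ContinuousLinearMap.proj j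

/-- The covector `dz̄_j`. -/
def dzbar {n : ℕ} (j : Fin n) : Cn n →L[ℝ] ℂ :=
  (Complex.conjCLE : ℂ →L[ℝ] ℂ).comp (dz j)

/-- The tangent vectors `∂/∂x_j` (for `s = 0`) and `∂/∂y_j` (for `s = 1`). -/
def realBasis {n : ℕ} (a : Fin n × Fin 2) : Cn n :=
  Pi.single a.1 (if a.2 = 0 then 1 else Complex.I)

/-- The derivative `∂ψ/∂z_j = (∂ψ/∂x_j - i ∂ψ/∂y_j) / 2`, coefficientwise. -/
def dDz {n k : ℕ} (j : Fin n) (ψ : Cn n → Alt n k) (u : Cn n) : Alt n k :=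
  (1 / 2 : ℂ) • (fderiv ℝ ψ u (realBasis (j, 0)) - Complex.I • fderiv ℝ ψ u (realBasis (j, 1)))

/-- The derivative `∂ψ/∂z̄_j = (∂ψ/∂x_j + i ∂ψ/∂y_j) / 2`, coefficientwise. -/
def dDzbar {n k : ℕ} (j : Fin n) (ψ : Cn n → Alt n k) (u : Cn n) : Alt n k :=
  (1 / 2 : ℂ) • (fderiv ℝ ψ u (realBasis (j, 0)) + Complex.I • fderiv ℝ ψ u (realBasis (j, 1)))

/-- The wedge product `θ ∧ ψ` of a covector and a `k`-form:
`(θ ∧ ψ)(v₀, …, vₖ) = ∑ᵢ (-1)ⁱ θ(vᵢ) ψ(v₀, …, v̂ᵢ, …, vₖ)`. -/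
def wedgeLeft {n k : ℕ} (θ : Cn n →L[ℝ] ℂ) (ψ : Alt n k) : Alt n (k + 1) :=
  ContinuousAlternatingMap.alternatizeUncurryFin (θ.smulRight ψ)

/-- The wedge product `θ₁ ∧ ⋯ ∧ θₖ` of a list of covectors. -/
def wedgeList {n : ℕ} : (L : List (Cn n →L[ℝ] ℂ)) → Alt n L.length
  | [] => ContinuousAlternatingMap.constOfIsEmpty ℝ (Cn n) (Fin 0) 1
  | θ :: L => wedgeLeft θ (wedgeList L)

/-- The local expression `ξ_j ψ = dz_j ∧ ∂ψ/∂z_j`, i.e.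
`f dz_α ∧ dz̄_β ↦ (∂f/∂z_j) dz_j ∧ dz_α ∧ dz̄_β`. -/
def xiLocal {n k : ℕ} (j : Fin n) (ψ : Cn n → Alt n k) (u : Cn n) : Alt n (k + 1) :=
  wedgeLeft (dz j) (dDz j ψ u)

/-- The local expression `dz̄_j ∧ ∂ψ/∂z̄_j`. -/
def xibarLocal {n k : ℕ} (j : Fin n) (ψ : Cn n → Alt n k) (u : Cn n) : Alt n (k + 1) :=
  wedgeLeft (dzbar j) (dDzbar j ψ u)

/-- `ξ_j (f θ₁ ∧ ⋯ ∧ θₖ) = (∂f/∂z_j) dz_j ∧ θ₁ ∧ ⋯ ∧ θₖ` for constant covectors `θᵢ`; in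
particular this holds for the forms `f dz_α ∧ dz̄_β`. -/
theorem xiLocal_smul_wedgeList {n : ℕ} (j : Fin n) (f : Cn n → ℂ) (u : Cn n)
    (hf : DifferentiableAt ℝ f u) (L : List (Cn n →L[ℝ] ℂ)) :
    xiLocal j (fun w => f w • wedgeList L) u =
      ((1 / 2 : ℂ) * (fderiv ℝ f u (realBasis (j, 0)) -
        Complex.I * fderiv ℝ f u (realBasis (j, 1)))) • wedgeList (dz j :: L) := by
  have h : fderiv ℝ (fun w => f w • wedgeList L) u =
      (fderiv ℝ f u).smulRight (wedgeList L) := (hf.hasFDerivAt.smul_const (wedgeList L)).fderiv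
  ext v
  simp only [xiLocal, dDz, h, wedgeList, wedgeLeft,
    ContinuousAlternatingMap.alternatizeUncurryFin_apply, ContinuousLinearMap.smulRight_apply,
    ContinuousAlternatingMap.smul_apply, ContinuousAlternatingMap.sub_apply, smul_eq_mul,
    Finset.mul_sum]
  refine Finset.sum_congr rfl fun i _ => ?_
  simp only [zsmul_eq_mul]
  ring

/-- The exterior derivative is `d = ∂ + ∂̄` with `∂ = ∑ⱼ ξⱼ` and `∂̄ = ∑ⱼ ξ̄ⱼ`. -/
theorem extDeriv_eq_sum_xiLocal {n k : ℕ} (ψ : Cn n → Alt n k) (u : Cn n) :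
    extDeriv ψ u = ∑ j, xiLocal j ψ u + ∑ j, xibarLocal j ψ u := by
  have hv : ∀ v : Cn n, v = ∑ j, ((v j).re • realBasis (j, 0) + (v j).im • realBasis (j, 1)) := by
    intro v
    ext l
    simp [Finset.sum_apply, realBasis, Pi.single_apply, Finset.sum_add_distrib]
  have key : fderiv ℝ ψ u = ∑ j, ((dz j).smulRight (dDz j ψ u) +
      (dzbar j).smulRight (dDzbar j ψ u)) := by
    ext1 v
    conv_lhs => rw [hv v]
    simp only [map_sum, map_add, map_smul, sum_apply,
      add_apply, ContinuousLinearMap.smulRight_apply]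
    refine Finset.sum_congr rfl fun j _ => ?_
    ext w
    simp only [dDz, dDzbar, dz, dzbar, ContinuousAlternatingMap.add_apply,
      ContinuousAlternatingMap.smul_apply, ContinuousAlternatingMap.sub_apply, smul_eq_mul,
      ContinuousLinearMap.proj_apply, ContinuousLinearMap.comp_apply, Complex.real_smul]
    generalize (fderiv ℝ ψ u (realBasis (j, 0))) w = A
    generalize (fderiv ℝ ψ u (realBasis (j, 1))) w = B
    simp only [ContinuousLinearEquiv.coe_coe, Complex.conjCLE_apply]
    generalize v j = z
    apply Complex.ext <;> simp <;> ring
  rw [extDeriv, key, ← Finset.sum_add_distrib]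
  simp only [← ContinuousAlternatingMap.alternatizeUncurryFinCLM_apply, map_sum, map_add]
  rfl

/-! ### The operators `ξ_j` on `X` -/

/-- The real linear map `v ↦ (0, …, c v_j, …, 0)`. -/
def coordMap {n : ℕ} (j : Fin n) (c : ℂ) : Cn n →L[ℝ] Cn n :=
  (ContinuousLinearMap.single ℝ (fun _ : Fin n => ℂ) j).comp
    ((ContinuousLinearMap.mul ℝ ℂ c).comp (dz j))

theorem coordMap_apply {n : ℕ} (j : Fin n) (c : ℂ) (v : Cn n) :
    coordMap j c v = Pi.single j (c * v j) := rfl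

/-- A map which is smooth at `u` and whose differential is complex diagonal near `u`. -/
def DiagonalAt {n : ℕ} (φ : Cn n → Cn n) (u : Cn n) : Prop :=
  ContDiffAt ℝ ∞ φ u ∧
    ∀ᶠ y in nhds u, ∀ (j : Fin n) (c : ℂ) (v : Cn n),
      fderiv ℝ φ y (coordMap j c v) = coordMap j c (fderiv ℝ φ y v)

theorem IsRigid.diagonalAt {n : ℕ} {φ : Cn n → Cn n} {U : Set (Cn n)} (h : IsRigid φ U)
    (hU : IsOpen U) {u : Cn n} (hu : u ∈ U) : DiagonalAt φ u := by
  obtain ⟨f, hf, hφ⟩ := h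
  have ho : ∀ j, IsOpen ((fun u : Cn n => u j) '' U) := fun j => isOpenMap_eval j _ hU
  have hev : ∀ y ∈ U, φ =ᶠ[nhds y] fun w j => f j (w j) := fun y hy => by
    filter_upwards [hU.mem_nhds hy] with w hw
    exact funext (hφ w hw)
  constructor
  · refine ContDiffAt.congr_of_eventuallyEq ?_ (hev u hu)
    rw [contDiffAt_pi]
    intro j
    have h1 : ContDiffAt ℂ ∞ (f j) (u j) :=
      ((hf j).contDiffOn (ho j)).contDiffAt ((ho j).mem_nhds ⟨u, hu, rfl⟩)
    exact (h1.restrict_scalars ℝ).comp u (dz j).contDiff.contDiffAt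
  · filter_upwards [hU.mem_nhds hu] with y hy j c v
    have hd : HasFDerivAt (fun (w : Cn n) j => f j (w j))
        (ContinuousLinearMap.pi fun l =>
          (ContinuousLinearMap.mul ℝ ℂ (deriv (f l) (y l))).comp (dz l)) y := by
      rw [hasFDerivAt_pi]
      intro l
      have h1 : HasDerivAt (f l) (deriv (f l) (y l)) (y l) :=
        ((hf l).differentiableAt ((ho l).mem_nhds ⟨y, hy, rfl⟩)).hasDerivAt
      have h2 := h1.hasFDerivAt.restrictScalars ℝ
      have h3 : HasFDerivAt (fun w : Cn n => w l) (dz l) y := (dz l).hasFDerivAt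
      refine (h2.comp y h3).congr_fderiv ?_
      ext v
      simp [mul_comm]
    rw [(hev y hy).fderiv_eq, hd.fderiv]
    ext l
    by_cases hl : l = j
    · subst hl
      simp [coordMap_apply, dz]
      ring
    · simp [coordMap_apply, dz, hl]

theorem DiagonalAt.comp {n : ℕ} {φ χ : Cn n → Cn n} {u : Cn n} (hχ : DiagonalAt χ (φ u))
    (hφ : DiagonalAt φ u) : DiagonalAt (χ ∘ φ) u := by
  refine ⟨hχ.1.comp u hφ.1, ?_⟩
  have h1 : ∀ᶠ y in nhds u, DifferentiableAt ℝ φ y :=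
    ((hφ.1.of_le (m := 1) (by simp)).eventually (by simp)).mono
      fun y hy => hy.differentiableAt (by simp)
  have h2 : ∀ᶠ y in nhds u, DifferentiableAt ℝ χ (φ y) :=
    hφ.1.continuousAt.eventually
      (((hχ.1.of_le (m := 1) (by simp)).eventually (by simp)).mono
        fun y hy => hy.differentiableAt (by simp))
  filter_upwards [h1, h2, hφ.2, hφ.1.continuousAt.eventually hχ.2] with y h1 h2 h3 h4 j c v
  rw [fderiv_comp y h2 h1]
  simp [h3, h4]

theorem DiagonalAt.congr {n : ℕ} {φ χ : Cn n → Cn n} {u : Cn n} (hχ : DiagonalAt χ u)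
    (h : φ =ᶠ[nhds u] χ) : DiagonalAt φ u := by
  refine ⟨hχ.1.congr_of_eventuallyEq h, ?_⟩
  filter_upwards [hχ.2, h.eventually_nhds] with y h1 h2
  rw [Filter.EventuallyEq.fderiv_eq h2]
  exact h1

theorem RigidChart.diagonalAt {n : ℕ} {X : Type*} [TopologicalSpace X] [ChartedSpace (Cn n) X]
    (e e' : RigidChart n X) {u : Cn n} (hu : u ∈ (transition e.1 e'.1).source) :
    DiagonalAt (transition e.1 e'.1) u := by
  set c := chartAt (Cn n) (e.1.symm u)
  have hc : c ∈ atlas (Cn n) X := chart_mem_atlas _ _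
  simp only [OpenPartialHomeomorph.trans_source, OpenPartialHomeomorph.symm_source,
    Set.mem_inter_iff, Set.mem_preimage] at hu
  have hs : e.1.symm u ∈ c.source := mem_chart_source _ _
  have hu1 : u ∈ (transition e.1 c).source := by simp [hu.1, hs]
  have h1 := (e.2 c hc).1.diagonalAt (transition e.1 c).open_source hu1
  have hu2 : transition e.1 c u ∈ (transition c e'.1).source := by
    simp [hs, hu.2]
  have h2 := (e'.2 c hc).2.diagonalAt (transition c e'.1).open_source hu2
  refine (h2.comp h1).congr ?_
  filter_upwards [(transition e.1 c).open_source.mem_nhds hu1] with y hy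
  simp only [OpenPartialHomeomorph.trans_source, OpenPartialHomeomorph.symm_source,
    Set.mem_inter_iff, Set.mem_preimage] at hy
  simp [c.left_inv hy.2]

theorem xiLocal_eq {n k : ℕ} (j : Fin n) (ψ : Cn n → Alt n k) (u : Cn n) :
    xiLocal j ψ u = (1 / 2 : ℂ) •
      (ContinuousAlternatingMap.alternatizeUncurryFin ((fderiv ℝ ψ u).comp (coordMap j 1)) -
        Complex.I • ContinuousAlternatingMap.alternatizeUncurryFin
          ((fderiv ℝ ψ u).comp (coordMap j Complex.I))) := by
  have h : ∀ (c : ℂ) (v : Cn n), coordMap j c v =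
      (c * v j).re • realBasis (j, 0) + (c * v j).im • realBasis (j, 1) := by
    intro c v
    ext l
    by_cases hl : l = j
    · subst hl
      apply Complex.ext <;> simp [coordMap_apply, realBasis]
    · simp [coordMap_apply, realBasis, hl]
  ext v
  simp only [xiLocal, wedgeLeft, ContinuousAlternatingMap.alternatizeUncurryFin_apply,
    ContinuousAlternatingMap.smul_apply, ContinuousAlternatingMap.sub_apply, smul_eq_mul,
    Finset.mul_sum, ← Finset.sum_sub_distrib, ContinuousLinearMap.comp_apply, h, map_add,
    map_smul, ContinuousLinearMap.smulRight_apply, dDz, ContinuousAlternatingMap.add_apply]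
  refine Finset.sum_congr rfl fun i _ => ?_
  generalize (fderiv ℝ ψ u (realBasis (j, 0))) (i.removeNth v) = A
  generalize (fderiv ℝ ψ u (realBasis (j, 1))) (i.removeNth v) = B
  simp only [dz, ContinuousLinearMap.proj_apply, zsmul_eq_mul, Complex.real_smul]
  generalize v i j = z
  have hz : z = z.re + z.im * Complex.I := (Complex.re_add_im z).symm
  have h1 : ((1 * z).re : ℂ) = z.re := by simp
  have h2 : ((1 * z).im : ℂ) = z.im := by simp
  have h3 : ((Complex.I * z).re : ℂ) = -z.im := by simp
  have h4 : ((Complex.I * z).im : ℂ) = z.re := by simp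
  rw [h1, h2, h3, h4]
  conv_lhs => rw [hz]
  linear_combination (-(1 / 2) * (((-1 : ℤ) ^ (i : ℕ) : ℤ) : ℂ) * z.im * B) * Complex.I_sq

/-- `ξ_j` commutes with the pullback along maps with complex diagonal differential. -/
theorem xiLocal_pullback {n k : ℕ} (j : Fin n) {ψ : Cn n → Alt n k} {φ : Cn n → Cn n} {u : Cn n}
    (hψ : DifferentiableAt ℝ ψ (φ u)) (hφ : DiagonalAt φ u) :
    xiLocal j (fun y => (ψ (φ y)).compContinuousLinearMap (fderiv ℝ φ y)) u =
      (xiLocal j ψ (φ u)).compContinuousLinearMap (fderiv ℝ φ u) := by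
  have hd : DifferentiableAt ℝ φ u := hφ.1.differentiableAt (by simp)
  have hd2 : DifferentiableAt ℝ (fderiv ℝ φ) u :=
    (hφ.1.fderiv_right (m := 1) (by norm_cast)).differentiableAt (by simp)
  have hsymm : ∀ x y, fderiv ℝ (fderiv ℝ φ) u x y = fderiv ℝ (fderiv ℝ φ) u y x :=
    fun x y => hφ.1.isSymmSndFDerivAt (by simp; norm_cast) x y
  have hcomm : ∀ (c : ℂ) (a v : Cn n), fderiv ℝ (fderiv ℝ φ) u a (coordMap j c v) =
      coordMap j c (fderiv ℝ (fderiv ℝ φ) u a v) := by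
    intro c a v
    have h1 : (fun y => fderiv ℝ φ y (coordMap j c v)) =ᶠ[nhds u]
        fun y => coordMap j c (fderiv ℝ φ y v) := hφ.2.mono fun y hy => hy j c v
    have h2 := hd2.hasFDerivAt.clm_apply (hasFDerivAt_const (coordMap j c v) u)
    have h3 := (coordMap j c).hasFDerivAt.comp u
      (hd2.hasFDerivAt.clm_apply (hasFDerivAt_const v u))
    have h4 := h2.unique (h3.congr_of_eventuallyEq h1)
    simpa using congrArg (fun T => T a) h4
  have hpart : ∀ c : ℂ, ContinuousAlternatingMap.alternatizeUncurryFin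
      ((fderiv ℝ (fun y => (ψ (φ y)).compContinuousLinearMap (fderiv ℝ φ y)) u).comp
        (coordMap j c)) =
      (ContinuousAlternatingMap.alternatizeUncurryFin
        ((fderiv ℝ ψ (φ u)).comp (coordMap j c))).compContinuousLinearMap (fderiv ℝ φ u) := by
    intro c
    rw [fderiv_continuousAlternatingMapCompContinuousLinearMap
        (f := fun y => ψ (φ y)) (hψ.comp u hd) hd2,
      ContinuousLinearMap.add_comp, ContinuousAlternatingMap.alternatizeUncurryFin_add,
      ContinuousLinearMap.comp_assoc, ContinuousLinearMap.comp_assoc,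
      ContinuousAlternatingMap.alternatizeUncurryFin_fderivCompContinuousLinearMap_eq_zero,
      add_zero, fderiv_fun_comp _ hψ hd]
    · ext v
      simp +unfoldPartialApp [ContinuousAlternatingMap.alternatizeUncurryFin_apply,
        Fin.removeNth, Function.comp_def, hφ.2.self_of_nhds j c]
    · intro x y
      simp only [ContinuousLinearMap.comp_apply]
      rw [hsymm, hcomm, hsymm, ← hcomm, hsymm]
  rw [xiLocal_eq, xiLocal_eq, hpart, hpart]
  rfl

theorem contDiffOn_xiLocal {n k : ℕ} (j : Fin n) {ψ : Cn n → Alt n k} {U : Set (Cn n)}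
    (hU : IsOpen U) (hψ : ContDiffOn ℝ ∞ ψ U) : ContDiffOn ℝ ∞ (xiLocal j ψ) U := by
  have h1 : ContDiffOn ℝ ∞ (fderiv ℝ ψ) U := hψ.fderiv_of_isOpen hU (by simp)
  have h2 : ∀ c : ℂ, ContDiffOn ℝ ∞ (fun u => ContinuousAlternatingMap.alternatizeUncurryFin
      ((fderiv ℝ ψ u).comp (coordMap j c))) U := fun c =>
    ContDiff.comp_contDiffOn
      (g := ContinuousAlternatingMap.alternatizeUncurryFinCLM ℝ (Cn n) ℂ)
      (ContinuousLinearMap.contDiff _)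
      (h1.clm_comp (contDiffOn_const (c := coordMap j c)))
  refine (((h2 1).sub ((h2 Complex.I).const_smul Complex.I)).const_smul (1 / 2 : ℂ)).congr ?_
  intro u _
  exact xiLocal_eq j ψ u

/-- The operator `ξ_j` from smooth `k`-forms on `X` to smooth `(k+1)`-forms on `X`: in each chart
`(z₁, …, zₙ)` it is `dz_j ∧ ∂/∂z_j`, the `dz_j`-component of the exterior derivative. -/
def xi {n : ℕ} (X : Type*) [TopologicalSpace X] [ChartedSpace (Cn n) X] (j : Fin n) (k : ℕ) :
    DiffForm n X k →ₗ[ℂ] DiffForm n X (k + 1) where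
  toFun ψ := ⟨fun e => e.1.target.indicator (xiLocal j (ψ.1 e)), by
    obtain ⟨ψ, h1, h2, h3⟩ := ψ
    refine ⟨fun e => ?_, fun e e' u hu => ?_, fun e u hu => Set.indicator_of_notMem hu _⟩
    · exact (contDiffOn_xiLocal j e.1.open_target (h1 e)).congr
        fun u hu => Set.indicator_of_mem hu _
    · dsimp only
      have hue : u ∈ e.1.target := hu.1
      have hue' : transition e.1 e'.1 u ∈ e'.1.target := e'.1.map_source hu.2
      rw [Set.indicator_of_mem hue, Set.indicator_of_mem hue', ← xiLocal_pullback j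
        (((h1 e').contDiffAt (e'.1.open_target.mem_nhds hue')).differentiableAt (by simp))
        (RigidChart.diagonalAt e e' hu)]
      have : ψ e =ᶠ[nhds u] fun y => (ψ e' (transition e.1 e'.1 y)).compContinuousLinearMap
          (fderiv ℝ (transition e.1 e'.1) y) :=
        Filter.eventually_of_mem ((transition e.1 e'.1).open_source.mem_nhds hu) (h2 e e')
      simp only [xiLocal, dDz, this.fderiv_eq]⟩
  map_add' := by
    rintro ⟨ψ, h1, h2, h3⟩ ⟨η, h1', h2', h3'⟩
    ext e u : 3
    by_cases hu : u ∈ e.1.target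
    · have hn := e.1.open_target.mem_nhds hu
      simp only [Submodule.coe_add, Pi.add_apply, Set.indicator_of_mem hu, xiLocal_eq]
      rw [fderiv_add (((h1 e).contDiffAt hn).differentiableAt (by simp))
        (((h1' e).contDiffAt hn).differentiableAt (by simp))]
      simp only [ContinuousLinearMap.add_comp, ContinuousAlternatingMap.alternatizeUncurryFin_add]
      module
    · simp [Set.indicator_of_notMem hu]
  map_smul' := by
    rintro c ⟨ψ, h1, h2, h3⟩
    ext e u : 3
    by_cases hu : u ∈ e.1.target
    · have hn := e.1.open_target.mem_nhds hu
      simp only [Submodule.coe_smul, Pi.smul_apply, Set.indicator_of_mem hu, xiLocal_eq,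
        RingHom.id_apply]
      rw [fderiv_const_smul (((h1 e).contDiffAt hn).differentiableAt (by simp))]
      simp only [ContinuousLinearMap.smul_comp,
        ContinuousAlternatingMap.alternatizeUncurryFin_smul]
      module
    · simp only [Set.indicator_of_notMem hu, Submodule.coe_smul, Pi.smul_apply]
      exact (smul_zero (A := Alt n (k + 1)) c).symm

/-! ### Hermitian metrics, volume and inner products -/

open scoped ComplexOrder in
/-- A smooth hermitian metric `ds² = ∑ h_{jk} dz_j ⊗ dz̄_k` on `X`, given by its coefficient
matrix `h = coeff e` in every chart `e`. Only the values on `e.target` matter. -/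
structure HermitianMetric (n : ℕ) (X : Type*) [TopologicalSpace X] [ChartedSpace (Cn n) X] where
  coeff : RigidChart n X → Cn n → Matrix (Fin n) (Fin n) ℂ
  smooth : ∀ e j k, ContDiffOn ℝ ∞ (fun u => coeff e u j k) e.1.target
  posDef : ∀ e, ∀ u ∈ e.1.target, (coeff e u).PosDef
  /-- Compatibility under a change of charts, with the Jacobian matrix `∂w_l/∂z_j`. -/
  compat : ∀ e e' : RigidChart n X, ∀ u ∈ (transition e.1 e'.1).source, ∀ j k,
    coeff e u j k = ∑ l, ∑ m,
      coeff e' (transition e.1 e'.1 u) l m *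
        fderiv ℝ (transition e.1 e'.1) u (realBasis (j, 0)) l *
          (starRingEnd ℂ) (fderiv ℝ (transition e.1 e'.1) u (realBasis (k, 0)) m)

/-- A hermitian metric is distinctive Kähler if every point `x` has a neighbourhood with
coordinates `(z₁, …, zₙ)` of the rigidified structure and a unitary coframe `φ_j = f_j(z_j) dz_j`
(that is, `ds² = ∑ φ_j ⊗ φ̄_j`) with `f_j` smooth and `∂f_j/∂z̄_j = 0` at `x`. -/
def HermitianMetric.IsDistinctiveKahler {n : ℕ} {X : Type*} [TopologicalSpace X]
    [ChartedSpace (Cn n) X] (g : HermitianMetric n X) : Prop :=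
  ∀ x : X, ∃ e : RigidChart n X, x ∈ e.1.source ∧ ∃ f : Fin n → ℂ → ℂ,
    (∀ j, ContDiffOn ℝ ∞ (f j) ((fun u : Cn n => u j) '' e.1.target)) ∧
    (∀ u ∈ e.1.target,
      g.coeff e u = Matrix.diagonal fun j => f j (u j) * (starRingEnd ℂ) (f j (u j))) ∧
    ∀ j, (1 / 2 : ℂ) * (fderiv ℝ (f j) (e.1 x j) 1 +
      Complex.I * fderiv ℝ (f j) (e.1 x j) Complex.I) = 0

/-- The volume measure of `ωⁿ / n!`, where `ω = (i/2) ∑ h_{jk} dz_j ∧ dz̄_k`. In a chart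
`ωⁿ / n! = det(h) dx₁ ∧ dy₁ ∧ ⋯ ∧ dxₙ ∧ dyₙ`, which gives a measure on the domain of the chart.
These measures agree on overlaps, so that their supremum is the measure on `X` which restricts
to each of them. -/
def HermitianMetric.vol {n : ℕ} {X : Type*} [TopologicalSpace X] [ChartedSpace (Cn n) X]
    [MeasurableSpace X] (g : HermitianMetric n X) : Measure X :=
  ⨆ e : RigidChart n X,
    (((volume : Measure (Cn n)).restrict e.1.target).withDensity
      fun u => ENNReal.ofReal (g.coeff e u).det.re).map e.1.symm

/-- The Gram matrix of the Riemannian metric `Re ds²` in the real basis `∂/∂x_j, ∂/∂y_j`. -/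
def realGram {n : ℕ} (h : Matrix (Fin n) (Fin n) ℂ) :
    Matrix (Fin n × Fin 2) (Fin n × Fin 2) ℝ :=
  Matrix.of fun a b =>
    (∑ j, ∑ k, h j k * realBasis a j * (starRingEnd ℂ) (realBasis b k)).re

/-- The hermitian inner product on complex valued `k`-forms induced by a hermitian metric on
`ℂⁿ`: `(ψ, η) = (1/k!) ∑ g^{a₁ b₁} ⋯ g^{aₖ bₖ} ψ_{a₁ … aₖ} conj(η_{b₁ … bₖ})`. -/
def formInner {n k : ℕ} (h : Matrix (Fin n) (Fin n) ℂ) (ψ η : Alt n k) : ℂ :=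
  (1 / (k.factorial : ℂ)) * ∑ a : Fin k → Fin n × Fin 2, ∑ b : Fin k → Fin n × Fin 2,
    (∏ i, (((realGram h)⁻¹ (a i) (b i) : ℝ) : ℂ)) *
      ψ (fun i => realBasis (a i)) * (starRingEnd ℂ) (η fun i => realBasis (b i))

/-- The inner product `⟨ψ, η⟩ = ∫_X (ψ(x), η(x)) ωⁿ / n!` of two forms. -/
def HermitianMetric.inner {n : ℕ} {X : Type*} [TopologicalSpace X] [ChartedSpace (Cn n) X]
    [IsRigidified n X] [MeasurableSpace X] (g : HermitianMetric n X) {k : ℕ}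
    (ψ η : DiffForm n X k) : ℂ :=
  ∫ x, formInner (g.coeff (rigidChartAt n x) ((rigidChartAt n x).1 x))
    (valueAt ψ x) (valueAt η x) ∂g.vol

/-- `P` is the formal adjoint of the operator `D` on forms: `⟨P ψ, η⟩ = ⟨ψ, D η⟩` for all `ψ` and
all compactly supported `η` (all `η` if `X` is compact). -/
def HermitianMetric.IsFormalAdjoint {n : ℕ} {X : Type*} [TopologicalSpace X]
    [ChartedSpace (Cn n) X] [IsRigidified n X] [MeasurableSpace X] (g : HermitianMetric n X)
    {k l : ℕ} (D : DiffForm n X k →ₗ[ℂ] DiffForm n X l)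
    (P : DiffForm n X l →ₗ[ℂ] DiffForm n X k) : Prop :=
  ∀ (ψ : DiffForm n X l) (η : DiffForm n X k), HasCompactSupport (valueAt η) →
    g.inner (P ψ) η = g.inner ψ (D η)

end RigidKahler

end

open RigidKahler

noncomputable section

namespace RigidKahler

/-! ### Linear algebra of forms on `ℂⁿ` -/

/-! The proof writes the adjoint down explicitly. Let `Λ_l` be contraction with `h_{ll}⁻¹ ∂/∂x_l ∧
∂/∂y_l` and let `ξ̄_l` be the `dz̄_l`-component of the exterior derivative. As in the Kähler
identities, the candidate (`HermitianMetric.adj`) is `ξ_l^* = i (Λ_l ξ̄_l - ξ̄_l Λ_l)`. Both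
operators are well defined on `X` because transition maps have complex diagonal differentials: the
pullback scales the bivector and `h_{ll}` by the same factor `|c_l|²`.

Anticommutation is then algebra. Near every point there is a rigid chart in which the metric is `∑
d_j(z_j) dz_j ⊗ dz̄_j`. For `j ≠ l` the coefficient `d_l⁻¹` is annihilated by `∂/∂z_j`, and `dz_j`
vanishes on the two vectors contracted by `Λ_l`. Hence `ξ_j` commutes with `Λ_l` (`xi_lambda`). It
anticommutes with `ξ̄_l`, since partial derivatives commute and covectors anticommute (`xi_xibar`).
So it anticommutes with both `Λ_l ξ̄_l` and `ξ̄_l Λ_l` (`xi_adj_add_adj_xi`).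

That the candidate is an adjoint rests on a divergence identity in a diagonal chart
(`wirtinger_flux`): `det h · ((ψ, ξ_l η) - (ξ_l^* ψ, η))` is the `∂/∂z̄_l`-derivative of an explicit
function `flux`. The only delicate term is the derivative of the metric weights. In the component
with multi-index `a`, the weight contains `d_l` to the power `-N`, where `N` counts the entries of
`a` with index `l`; the same `N` appears in `ξ_l^*` through `wedgeLeft_dzbar_contract_apply`. If `η`
is supported in the chart, the flux has compact support and its derivative integrates to zero. A
partition of unity treats a general compactly supported `η`.

Uniqueness follows from nondegeneracy of the pairing, by testing a form against its product with a
bump function (`eq_zero_of_inner`). Therefore every formal adjoint equals the explicit operator and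
inherits the anticommutation. -/

instance {n k : ℕ} : SMulWithZero ℂ (Alt n k) :=
  (ContinuousAlternatingMap.instModule : Module ℂ (Alt n k)).toMulActionWithZero.toSMulWithZero

/-- The coordinate dual to `realBasis a`. -/
def realCoord {n : ℕ} (a : Fin n × Fin 2) (v : Cn n) : ℝ :=
  if a.2 = 0 then (v a.1).re else (v a.1).im

theorem sum_realCoord {n : ℕ} (v : Cn n) : ∑ a, realCoord a v • realBasis a = v := by
  ext l
  simp [Fintype.sum_prod_type, realCoord, realBasis, Pi.single_apply, Finset.sum_add_distrib]

/-- A form is determined by its coefficients with respect to the real basis. -/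
theorem apply_eq_sum_realCoord {n k : ℕ} (α : Alt n k) (v : Fin k → Cn n) :
    α v = ∑ a : Fin k → Fin n × Fin 2,
      (∏ i, (realCoord (a i) (v i) : ℂ)) * α fun i => realBasis (a i) := by
  classical
  have h : v = fun i => ∑ a, realCoord a (v i) • realBasis a :=
    funext fun i => (sum_realCoord (v i)).symm
  conv_lhs => rw [h]
  rw [← ContinuousAlternatingMap.coe_toContinuousMultilinearMap, 
    ContinuousMultilinearMap.map_sum]
  refine Finset.sum_congr rfl fun a _ => ?_
  rw [ContinuousMultilinearMap.map_smul_univ]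
  simp

theorem ext_realBasis {n k : ℕ} {α β : Alt n k}
    (h : ∀ a : Fin k → Fin n × Fin 2,
      α (fun i => realBasis (a i)) = β fun i => realBasis (a i)) : α = β := by
  ext v
  rw [apply_eq_sum_realCoord α, apply_eq_sum_realCoord β]
  simp only [h]

/-! ### Exterior products with covectors and interior products with vectors. -/

theorem map_vecCons_self {n k : ℕ} (α : Alt n (k + 2)) (v : Cn n) (w : Fin k → Cn n) :
    α (Matrix.vecCons v (Matrix.vecCons v w)) = 0 :=
  α.map_eq_zero_of_eq _ (i := 0) (j := 1) (by simp) (by simp)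

theorem map_vecCons_swap {n k : ℕ} (α : Alt n (k + 2)) (v v' : Cn n) (w : Fin k → Cn n) :
    α (Matrix.vecCons v (Matrix.vecCons v' w)) = -α (Matrix.vecCons v' (Matrix.vecCons v w)) := by
  have := α.map_swap (Matrix.vecCons v' (Matrix.vecCons v w)) (i := 0) (j := 1) (by simp)
  refine Eq.trans ?_ this
  refine congrArg α (funext fun l => ?_)
  refine Fin.cases ?_ (fun l => Fin.cases ?_ (fun l => ?_) l) l
  · simp
  · simp
  · rw [Function.comp_apply, Equiv.swap_apply_of_ne_of_ne (by simp [Fin.ext_iff])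
      (by simp [Fin.ext_iff])]
    simp

theorem wedgeLeft_apply {n k : ℕ} (θ : Cn n →L[ℝ] ℂ) (α : Alt n k) (v : Fin (k + 1) → Cn n) :
    wedgeLeft θ α v = ∑ i : Fin (k + 1), (-1) ^ (i : ℕ) * (θ (v i) * α (i.removeNth v)) := by
  simp [wedgeLeft, ContinuousAlternatingMap.alternatizeUncurryFin_apply]

/-- The wedge product with a covector, as a continuous linear map. -/
def wedgeCLM {n : ℕ} (θ : Cn n →L[ℝ] ℂ) (k : ℕ) : Alt n k →L[ℂ] Alt n (k + 1) where
  toFun := wedgeLeft θ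
  map_add' α β := by
    ext v
    simp [wedgeLeft_apply, mul_add, Finset.sum_add_distrib]
  map_smul' c α := by
    ext v
    simp only [wedgeLeft_apply, ContinuousAlternatingMap.smul_apply, smul_eq_mul,
      RingHom.id_apply, Finset.mul_sum]
    exact Finset.sum_congr rfl fun i _ => by ring
  cont := ((ContinuousAlternatingMap.alternatizeUncurryFinCLM ℝ (Cn n) ℂ).comp
    (((ContinuousLinearMap.compL ℝ (Cn n) ℂ (Alt n k)).flip θ).comp
      (ContinuousLinearMap.lsmul ℝ ℂ).flip)).continuous

@[simp] theorem wedgeCLM_apply {n k : ℕ} (θ : Cn n →L[ℝ] ℂ) (α : Alt n k) :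
    wedgeCLM θ k α = wedgeLeft θ α := rfl

/-- The interior product with a vector. -/
def interiorProd {n : ℕ} (v : Cn n) (k : ℕ) : Alt n (k + 1) →L[ℂ] Alt n k where
  toFun α := α.curryLeft v
  map_add' _ _ := rfl
  map_smul' _ _ := rfl
  cont := ((ContinuousLinearMap.apply ℝ (Alt n k) v).comp
    (ContinuousAlternatingMap.curryLeftLI (𝕜 := ℝ) (E := Cn n)
      (F := ℂ)).toContinuousLinearMap).continuous

theorem interiorProd_apply {n k : ℕ} (v : Cn n) (α : Alt n (k + 1)) (w : Fin k → Cn n) :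
    interiorProd v k α w = α (Matrix.vecCons v w) := rfl

/-- The antiderivation rule: the term of the alternating sum in which `θ` takes the first slot gives
`θ v • α`, and in all others `v` stays in front while the sign index shifts by one. Degree zero
needs the separate version below because `α` then has no interior product. -/
theorem interiorProd_wedgeLeft {n k : ℕ} (v : Cn n) (θ : Cn n →L[ℝ] ℂ) (α : Alt n (k + 1)) :
    interiorProd v (k + 1) (wedgeLeft θ α) = θ v • α - wedgeLeft θ (interiorProd v k α) := by
  ext w
  rw [interiorProd_apply, wedgeLeft_apply, Fin.sum_univ_succ, ContinuousAlternatingMap.sub_apply,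
    wedgeLeft_apply, sub_eq_add_neg, ← Finset.sum_neg_distrib]
  congr 1
  · simp [Matrix.vecCons]
  · refine Finset.sum_congr rfl fun i _ => ?_
    have : (Fin.succ i).removeNth (Matrix.vecCons v w) = Matrix.vecCons v (i.removeNth w) := by
      ext j : 1
      cases j using Fin.cases <;> simp [Fin.removeNth]
    simp [this, interiorProd_apply, pow_succ]

theorem interiorProd_wedgeLeft_zero {n : ℕ} (v : Cn n) (θ : Cn n →L[ℝ] ℂ) (α : Alt n 0) :
    interiorProd v 0 (wedgeLeft θ α) = θ v • α := by
  ext w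
  simp [interiorProd_apply, wedgeLeft_apply, Subsingleton.elim _ w]

/-- The double wedge is the twofold alternatization of the bilinear map `(x, y) ↦ θ(x) θ(y) α`,
which is symmetric. -/
theorem wedgeLeft_self {n k : ℕ} (θ : Cn n →L[ℝ] ℂ) (α : Alt n k) :
    wedgeLeft θ (wedgeLeft θ α) = 0 := by
  let f : Cn n →L[ℝ] Cn n →L[ℝ] Alt n k :=
    (((ContinuousLinearMap.compL ℝ (Cn n) (Alt n k) (Alt n k)).flip (θ.smulRight α)).comp
      (ContinuousLinearMap.lsmul ℝ ℂ)).comp θ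
  rw [← ContinuousAlternatingMap.alternatizeUncurryFin_alternatizeUncurryFinCLM_comp_of_symmetric
    (f := f) fun x y => smul_comm (θ x) (θ y) α]
  unfold wedgeLeft
  congr 1
  ext1 v
  exact (ContinuousAlternatingMap.alternatizeUncurryFin_smul (θ v) (θ.smulRight α)).symm

theorem add_wedgeLeft {n k : ℕ} (θ θ' : Cn n →L[ℝ] ℂ) (α : Alt n k) :
    wedgeLeft (θ + θ') α = wedgeLeft θ α + wedgeLeft θ' α := by
  ext v
  simp [wedgeLeft_apply, add_mul, mul_add, Finset.sum_add_distrib]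

theorem wedgeLeft_add {n k : ℕ} (θ : Cn n →L[ℝ] ℂ) (α β : Alt n k) :
    wedgeLeft θ (α + β) = wedgeLeft θ α + wedgeLeft θ β :=
  map_add (wedgeCLM θ k) α β

/-- Polarization of `wedgeLeft_self` at `θ + θ'`. -/
theorem wedgeLeft_wedgeLeft {n k : ℕ} (θ θ' : Cn n →L[ℝ] ℂ) (α : Alt n k) :
    wedgeLeft θ (wedgeLeft θ' α) = -wedgeLeft θ' (wedgeLeft θ α) := by
  have h := wedgeLeft_self (θ + θ') α
  rw [add_wedgeLeft, add_wedgeLeft, wedgeLeft_add, wedgeLeft_add, wedgeLeft_self,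
    wedgeLeft_self, add_zero, zero_add] at h
  exact eq_neg_of_add_eq_zero_left h

/-! ### Contractions with `2 ∂/∂z_j` and with `∂/∂x_j ∧ ∂/∂y_j`. -/

theorem dz_realBasis {n : ℕ} (j : Fin n) (a : Fin n × Fin 2) :
    dz j (realBasis a) = if a.1 = j then (if a.2 = 0 then 1 else Complex.I) else 0 := by
  simp [dz, realBasis, Pi.single_apply, eq_comm]

theorem dzbar_realBasis {n : ℕ} (j : Fin n) (a : Fin n × Fin 2) :
    dzbar j (realBasis a) = if a.1 = j then (if a.2 = 0 then 1 else -Complex.I) else 0 := by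
  have : dzbar j (realBasis a) = (starRingEnd ℂ) (dz j (realBasis a)) := rfl
  rw [this, dz_realBasis]
  split_ifs <;> simp

/-- The interior product with `2 ∂/∂z_j = ∂/∂x_j - i ∂/∂y_j`. -/
def interiorZ {n : ℕ} (j : Fin n) (k : ℕ) : Alt n (k + 1) →L[ℂ] Alt n k :=
  interiorProd (realBasis (j, 0)) k - Complex.I • interiorProd (realBasis (j, 1)) k

/-- The contraction with the bivector `∂/∂x_j ∧ ∂/∂y_j`. -/
def contract {n : ℕ} (j : Fin n) (k : ℕ) : Alt n (k + 2) →L[ℂ] Alt n k :=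
  (interiorProd (realBasis (j, 1)) k).comp (interiorProd (realBasis (j, 0)) (k + 1))

theorem contract_apply {n k : ℕ} (j : Fin n) (α : Alt n (k + 2)) (w : Fin k → Cn n) :
    contract j k α w =
      α (Matrix.vecCons (realBasis (j, 0)) (Matrix.vecCons (realBasis (j, 1)) w)) := rfl

/-- The pointwise Kähler identity `[Λ, dz̄_j ∧] = i ι`. Since `dz̄_j` takes the values `1` and `-i`
on `∂/∂x_j` and `∂/∂y_j`, two uses of the antiderivation rule produce `ι_y + i ι_x = i (ι_x - i
ι_y)`, and the two signs in front of `dz̄_j ∧` cancel. -/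
theorem contract_wedgeLeft_dzbar {n k : ℕ} (j : Fin n) (α : Alt n (k + 2)) :
    contract j (k + 1) (wedgeLeft (dzbar j) α) =
      Complex.I • interiorZ j (k + 1) α + wedgeLeft (dzbar j) (contract j k α) := by
  simp only [contract, ContinuousLinearMap.comp_apply, interiorProd_wedgeLeft, map_sub, map_smul,
    dzbar_realBasis, interiorZ, sub_apply, smul_apply]
  simp only [if_true, Fin.one_eq_zero_iff, Nat.reduceEqDiff, if_false, one_smul]
  rw [smul_sub, smul_smul, Complex.I_mul_I]
  module

theorem contract_wedgeLeft_dzbar_zero {n : ℕ} (j : Fin n) (α : Alt n 1) :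
    contract j 0 (wedgeLeft (dzbar j) α) = Complex.I • interiorZ j 0 α := by
  simp only [contract, ContinuousLinearMap.comp_apply, interiorProd_wedgeLeft, map_sub, map_smul,
    dzbar_realBasis, interiorZ, sub_apply, smul_apply,
    interiorProd_wedgeLeft_zero]
  simp only [if_true, Fin.one_eq_zero_iff, Nat.reduceEqDiff, if_false, one_smul]
  rw [smul_sub, smul_smul, Complex.I_mul_I]
  module

/-- For `j ≠ l` the covector `dz_j` vanishes on both contracted vectors, so only the two sign
changes remain, and they cancel. -/
theorem contract_wedgeLeft_dz {n k : ℕ} {j l : Fin n} (h : j ≠ l) (α : Alt n (k + 2)) :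
    contract l (k + 1) (wedgeLeft (dz j) α) = wedgeLeft (dz j) (contract l k α) := by
  simp [contract, interiorProd_wedgeLeft, dz_realBasis, h.symm]

theorem contract_wedgeLeft_dz_zero {n : ℕ} {j l : Fin n} (h : j ≠ l) (α : Alt n 1) :
    contract l 0 (wedgeLeft (dz j) α) = 0 := by
  simp [contract, interiorProd_wedgeLeft, interiorProd_wedgeLeft_zero, dz_realBasis, h.symm]

/-- On the real basis, `dz̄_j ∧ (∂/∂x_j ∧ ∂/∂y_j ⌟ α)` counts the indices equal to `j` in the
coefficients of `2 ∂/∂z_j ⌟ α`. -/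
theorem wedgeLeft_dzbar_contract_apply {n k : ℕ} (j : Fin n) (α : Alt n (k + 2))
    (a : Fin (k + 1) → Fin n × Fin 2) :
    Complex.I * wedgeLeft (dzbar j) (contract j k α) (fun i => realBasis (a i)) =
      (∑ i, if (a i).1 = j then (1 : ℂ) else 0) *
        interiorZ j (k + 1) α fun i => realBasis (a i) := by
  rw [wedgeLeft_apply, Finset.mul_sum, Finset.sum_mul]
  refine Finset.sum_congr rfl fun i _ => ?_
  rw [dzbar_realBasis]
  by_cases hj : (a i).1 = j
  -- Move the `i`-th vector, which is `∂/∂x_j` or `∂/∂y_j`, to the front. Of the two terms of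
  -- `interiorZ` one then has a repeated vector and vanishes; the other is `i` times the contraction
  -- with the bivector. Thus each slot with index `j` contributes one full copy of the value of
  -- `interiorZ`.
  · set w : Fin k → Cn n := i.removeNth fun i => realBasis (a i) with hw
    have hv : (fun i => realBasis (a i)) = i.insertNth (realBasis (a i)) w :=
      (Fin.insertNth_self_removeNth i _).symm
    have h0 : ∀ v, α (Matrix.vecCons v (Matrix.vecCons v w)) = 0 := fun v =>
      map_vecCons_self α v w
    rw [hv]
    simp only [interiorZ, sub_apply, smul_apply,
      ContinuousAlternatingMap.sub_apply, ContinuousAlternatingMap.smul_apply, interiorProd_apply,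
      contract_apply, ContinuousAlternatingMap.map_insertNth]
    rcases ha : a i with ⟨l, s⟩
    obtain rfl : l = j := by simpa [ha] using hj
    match s with
    | 0 => simp [h0, map_vecCons_swap α (realBasis (l, 1))]
    | 1 => simp [h0]; ring_nf; simp
  · simp [hj]

/-! ### The inner product of forms on `ℂⁿ` -/

theorem realGram_diagonal {n : ℕ} (d : Fin n → ℝ) :
    realGram (Matrix.diagonal fun j => (d j : ℂ)) = Matrix.diagonal fun a => d a.1 := by
  ext ⟨i, s⟩ ⟨j, t⟩
  have h : ∀ (x : Fin n), (∑ k, Matrix.diagonal (fun j => (d j : ℂ)) x k *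
      realBasis (i, s) x * (starRingEnd ℂ) (realBasis (j, t) k)) =
      d x * realBasis (i, s) x * (starRingEnd ℂ) (realBasis (j, t) x) := fun x => by
    rw [Finset.sum_eq_single x] <;> simp +contextual [eq_comm]
  simp only [realGram, Matrix.of_apply, h]
  rw [Finset.sum_eq_single i (by simp +contextual [realBasis]) (by simp)]
  by_cases hij : i = j
  · subst hij
    fin_cases s <;> fin_cases t <;> simp [realBasis]
  · simp [realBasis, hij]

theorem inv_realGram_diagonal {n : ℕ} {d : Fin n → ℝ} (hd : ∀ j, d j ≠ 0) :
    (realGram (Matrix.diagonal fun j => (d j : ℂ)))⁻¹ = Matrix.diagonal fun a => (d a.1)⁻¹ := by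
  rw [realGram_diagonal]
  refine Matrix.inv_eq_right_inv ?_
  simp [hd]

theorem formInner_diagonal {n k : ℕ} {d : Fin n → ℝ} (hd : ∀ j, d j ≠ 0) (ψ η : Alt n k) :
    formInner (Matrix.diagonal fun j => (d j : ℂ)) ψ η =
      (1 / (k.factorial : ℂ)) * ∑ a : Fin k → Fin n × Fin 2,
        (∏ i, (d (a i).1 : ℂ)⁻¹) * ψ (fun i => realBasis (a i)) *
          (starRingEnd ℂ) (η fun i => realBasis (a i)) := by
  rw [formInner, inv_realGram_diagonal hd]
  congr 1
  refine Finset.sum_congr rfl fun a _ => ?_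
  rw [Finset.sum_eq_single a]
  · simp
  · intro b _ hb
    obtain ⟨i, hi⟩ := Function.ne_iff.1 hb
    rw [Finset.prod_eq_zero (Finset.mem_univ i)] <;> simp [hi.symm]
  · simp

theorem formInner_add_left {n k : ℕ} (h : Matrix (Fin n) (Fin n) ℂ) (ψ ψ' η : Alt n k) :
    formInner h (ψ + ψ') η = formInner h ψ η + formInner h ψ' η := by
  simp only [formInner, ContinuousAlternatingMap.add_apply, mul_add, add_mul,
    Finset.sum_add_distrib]

theorem formInner_smul_left {n k : ℕ} (h : Matrix (Fin n) (Fin n) ℂ) (c : ℂ) (ψ η : Alt n k) :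
    formInner h (c • ψ) η = c * formInner h ψ η := by
  simp only [formInner, ContinuousAlternatingMap.smul_apply, smul_eq_mul, Finset.mul_sum]
  exact Finset.sum_congr rfl fun a _ => Finset.sum_congr rfl fun b _ => by ring

theorem formInner_add_right {n k : ℕ} (h : Matrix (Fin n) (Fin n) ℂ) (ψ η η' : Alt n k) :
    formInner h ψ (η + η') = formInner h ψ η + formInner h ψ η' := by
  simp only [formInner, ContinuousAlternatingMap.add_apply, mul_add, map_add,
    Finset.sum_add_distrib]

theorem formInner_smul_right {n k : ℕ} (h : Matrix (Fin n) (Fin n) ℂ) (c : ℂ) (ψ η : Alt n k) :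
    formInner h ψ (c • η) = (starRingEnd ℂ) c * formInner h ψ η := by
  simp only [formInner, ContinuousAlternatingMap.smul_apply, smul_eq_mul, Finset.mul_sum, map_mul]
  exact Finset.sum_congr rfl fun a _ => Finset.sum_congr rfl fun b _ => by ring

theorem formInner_zero_right {n k : ℕ} (h : Matrix (Fin n) (Fin n) ℂ) (ψ : Alt n k) :
    formInner h ψ 0 = 0 := by
  simp [formInner]

theorem formInner_self_eq {n k : ℕ} {d : Fin n → ℝ} (hd : ∀ j, d j ≠ 0) (ψ : Alt n k) :
    formInner (Matrix.diagonal fun j => (d j : ℂ)) ψ ψ =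
      ((1 / (k.factorial : ℝ)) * ∑ a : Fin k → Fin n × Fin 2,
        (∏ i, (d (a i).1)⁻¹) * Complex.normSq (ψ fun i => realBasis (a i)) : ℝ) := by
  rw [formInner_diagonal hd]
  push_cast
  simp only [← Complex.mul_conj, mul_assoc]

theorem formInner_self_nonneg {n k : ℕ} {d : Fin n → ℝ} (hd : ∀ j, 0 < d j) (ψ : Alt n k) :
    0 ≤ (formInner (Matrix.diagonal fun j => (d j : ℂ)) ψ ψ).re := by
  rw [formInner_self_eq fun j => (hd j).ne', Complex.ofReal_re]
  exact mul_nonneg (by positivity) (Finset.sum_nonneg fun a _ =>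
    mul_nonneg (Finset.prod_nonneg fun i _ => (inv_pos.2 (hd _)).le) (Complex.normSq_nonneg _))

theorem eq_zero_of_formInner_self {n k : ℕ} {d : Fin n → ℝ} (hd : ∀ j, 0 < d j) {ψ : Alt n k}
    (h : (formInner (Matrix.diagonal fun j => (d j : ℂ)) ψ ψ).re = 0) : ψ = 0 := by
  rw [formInner_self_eq fun j => (hd j).ne', Complex.ofReal_re] at h
  have hp : ∀ a : Fin k → Fin n × Fin 2, 0 < ∏ i, (d (a i).1)⁻¹ := fun a =>
    Finset.prod_pos fun i _ => inv_pos.2 (hd _)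
  have h1 := (mul_eq_zero.1 h).resolve_left (by positivity)
  rw [Finset.sum_eq_zero_iff_of_nonneg fun a _ =>
    mul_nonneg (hp a).le (Complex.normSq_nonneg _)] at h1
  refine ext_realBasis fun a => ?_
  simpa using (mul_eq_zero.1 (h1 a (Finset.mem_univ a))).resolve_left (hp a).ne'

/-- The adjoint of the wedge product with `dz_j` is the interior product with `2 ∂/∂z_j`, divided
by the metric coefficient. -/
theorem formInner_wedgeLeft_dz {n k : ℕ} {d : Fin n → ℝ} (hd : ∀ j, d j ≠ 0) (j : Fin n)
    (ψ : Alt n (k + 1)) (η : Alt n k) :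
    formInner (Matrix.diagonal fun j => (d j : ℂ)) ψ (wedgeLeft (dz j) η) =
      (d j : ℂ)⁻¹ * formInner (Matrix.diagonal fun j => (d j : ℂ)) (interiorZ j k ψ) η := by
  rw [formInner_diagonal hd, formInner_diagonal hd]
  -- Each of the `k + 1` slots that `dz_j` can occupy contributes the same amount, which turns
  -- `1/(k+1)!` into `1/k!`.
  have h1 : ∀ i : Fin (k + 1), ∑ a : Fin (k + 1) → Fin n × Fin 2,
      (∏ i, (d (a i).1 : ℂ)⁻¹) * ψ (fun i => realBasis (a i)) *
        (starRingEnd ℂ) ((-1) ^ (i : ℕ) * (dz j (realBasis (a i)) *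
          η (i.removeNth fun i => realBasis (a i)))) =
      (d j : ℂ)⁻¹ * ∑ b : Fin k → Fin n × Fin 2,
        (∏ i, (d (b i).1 : ℂ)⁻¹) * interiorZ j k ψ (fun i => realBasis (b i)) *
          (starRingEnd ℂ) (η fun i => realBasis (b i)) := by
    intro i
    -- Split off the `i`-th index `p`. Only `p = (j, s)` survives, and the conjugates `1, -i` of the
    -- values of `dz_j` assemble `∂/∂x_j - i ∂/∂y_j`. The sign from moving `p` to the front cancels
    -- the sign of the wedge.
    rw [← (Fin.insertNthEquiv (fun _ => Fin n × Fin 2) i).sum_comp, Fintype.sum_prod_type]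
    rw [Finset.sum_comm, Finset.mul_sum]
    refine Finset.sum_congr rfl fun b _ => ?_
    have hb : ∀ p, (fun l => realBasis ((i.insertNth p b : Fin (k + 1) → Fin n × Fin 2) l)) =
        (i.insertNth (realBasis p) fun l => realBasis (b l) : Fin (k + 1) → Cn n) := fun p => by
      ext1 l
      refine Fin.succAboveCases i ?_ (fun l => ?_) l <;> simp
    simp only [Fin.insertNthEquiv_apply, hb, ContinuousAlternatingMap.map_insertNth,
      Fin.prod_univ_succAbove _ i, Fin.insertNth_apply_same, Fin.insertNth_apply_succAbove,
      dz_realBasis]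
    rw [Fintype.sum_prod_type, Finset.sum_eq_single j]
    · have hsq : ((-1 : ℂ) ^ (i : ℕ)) * (-1) ^ (i : ℕ) = 1 := by
        rw [← mul_pow]; simp
      simp [interiorZ, interiorProd_apply]
      linear_combination (norm := ring_nf) hsq * ((d j : ℂ)⁻¹ * (∏ x, (d (b x).1 : ℂ))⁻¹ *
        (ψ (Matrix.vecCons (realBasis (j, 0)) fun l => realBasis (b l)) -
          Complex.I * ψ (Matrix.vecCons (realBasis (j, 1)) fun l => realBasis (b l))) *
        (starRingEnd ℂ) (η fun l => realBasis (b l)))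
    · intro l _ hl
      simp [hl]
    · simp
  simp only [wedgeLeft_apply, map_sum, Finset.mul_sum]
  rw [Finset.sum_comm]
  simp only [← Finset.mul_sum]
  simp only [h1]
  simp [Nat.factorial_succ]
  have : (k : ℂ) + 1 ≠ 0 := by exact_mod_cast Nat.succ_ne_zero k
  field_simp

/-- The complex diagonal map `v ↦ (c₁ v₁, …, cₙ vₙ)`. -/
def diagMap {n : ℕ} (c : Fin n → ℂ) : Cn n →L[ℝ] Cn n :=
  ContinuousLinearMap.pi fun l => (ContinuousLinearMap.mul ℝ ℂ (c l)).comp (dz l)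

@[simp] theorem diagMap_apply {n : ℕ} (c : Fin n → ℂ) (v : Cn n) (l : Fin n) :
    diagMap c v l = c l * v l := rfl

theorem realCoord_realBasis {n : ℕ} (p q : Fin n × Fin 2) :
    realCoord p (realBasis q) = if p = q then 1 else 0 := by
  obtain ⟨i, s⟩ := p
  obtain ⟨j, t⟩ := q
  by_cases hij : i = j
  · subst hij
    fin_cases s <;> fin_cases t <;> simp [realCoord, realBasis]
  · simp [realCoord, realBasis, hij]

/-- The real matrix of `diagMap c`. -/
def diagMatrix {n : ℕ} (c : Fin n → ℂ) : Matrix (Fin n × Fin 2) (Fin n × Fin 2) ℝ :=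
  Matrix.of fun p q => realCoord p (diagMap c (realBasis q))

theorem realCoord_sum_smul {n : ℕ} {ι : Type*} (s : Finset ι) (r : ι → ℝ) (v : ι → Cn n)
    (p : Fin n × Fin 2) : realCoord p (∑ i ∈ s, r i • v i) = ∑ i ∈ s, r i * realCoord p (v i) := by
  unfold realCoord
  split_ifs <;> simp [Finset.sum_apply]

theorem diagMatrix_mul {n : ℕ} (c c' : Fin n → ℂ) :
    diagMatrix c * diagMatrix c' = diagMatrix fun l => c l * c' l := by
  ext p q
  simp only [Matrix.mul_apply, diagMatrix, Matrix.of_apply]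
  have h : diagMap (fun l => c l * c' l) (realBasis q) =
      ∑ r, realCoord r (diagMap c' (realBasis q)) • diagMap c (realBasis r) := by
    simp only [← map_smul, ← map_sum, sum_realCoord]
    ext l
    simp [mul_assoc]
  rw [h, realCoord_sum_smul]
  exact Finset.sum_congr rfl fun r _ => mul_comm _ _

theorem diagMatrix_one {n : ℕ} : diagMatrix (fun _ : Fin n => 1) = 1 := by
  ext p q
  have : diagMap (fun _ : Fin n => 1) (realBasis q) = realBasis q := by ext l; simp
  simp [diagMatrix, this, realCoord_realBasis, Matrix.one_apply]

/-- The real part of a hermitian form, as a real bilinear form. -/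
def realForm {n : ℕ} (h : Matrix (Fin n) (Fin n) ℂ) : Cn n →ₗ[ℝ] Cn n →ₗ[ℝ] ℝ :=
  LinearMap.mk₂ ℝ (fun v w => (∑ j, ∑ k, h j k * v j * (starRingEnd ℂ) (w k)).re)
    (fun v v' w => by
      simp only [Pi.add_apply, mul_add, add_mul, Finset.sum_add_distrib, Complex.add_re])
    (fun r v w => by
      rw [smul_eq_mul, ← Complex.re_ofReal_mul, Finset.mul_sum]
      simp only [Finset.mul_sum, Pi.smul_apply, Complex.real_smul]
      congr 1
      exact Finset.sum_congr rfl fun j _ => Finset.sum_congr rfl fun k _ => by ring)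
    (fun v w w' => by
      simp only [Pi.add_apply, mul_add, map_add, Finset.sum_add_distrib, Complex.add_re])
    (fun r v w => by
      rw [smul_eq_mul, ← Complex.re_ofReal_mul, Finset.mul_sum]
      simp only [Finset.mul_sum, Pi.smul_apply, Complex.real_smul, map_mul, Complex.conj_ofReal]
      congr 1
      exact Finset.sum_congr rfl fun j _ => Finset.sum_congr rfl fun k _ => by ring)

theorem realGram_apply {n : ℕ} (h : Matrix (Fin n) (Fin n) ℂ) (p q : Fin n × Fin 2) :
    realGram h p q = realForm h (realBasis p) (realBasis q) := rfl

/-- The real part of a pulled back hermitian form is the pullback of the real part, so the Gram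
matrix changes by the congruence `Bᵀ G B`. -/
theorem realGram_pullback {n : ℕ} (h : Matrix (Fin n) (Fin n) ℂ) (c : Fin n → ℂ) :
    realGram (Matrix.of fun j k => h j k * c j * (starRingEnd ℂ) (c k)) =
      (diagMatrix c).transpose * realGram h * diagMatrix c := by
  ext p q
  have h1 : realGram (Matrix.of fun j k => h j k * c j * (starRingEnd ℂ) (c k)) p q =
      realForm h (diagMap c (realBasis p)) (diagMap c (realBasis q)) := by
    simp only [realGram, realForm, LinearMap.mk₂_apply, Matrix.of_apply, diagMap_apply, map_mul]
    congr 1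
    exact Finset.sum_congr rfl fun j _ => Finset.sum_congr rfl fun k _ => by ring
  rw [h1, ← sum_realCoord (diagMap c (realBasis p)), ← sum_realCoord (diagMap c (realBasis q))]
  simp only [map_sum, map_smul, LinearMap.sum_apply, LinearMap.smul_apply, Matrix.mul_apply,
    Matrix.transpose_apply, realGram_apply, diagMatrix, Matrix.of_apply, smul_eq_mul,
    Finset.sum_mul, Finset.mul_sum]
  exact Finset.sum_congr rfl fun r _ => Finset.sum_congr rfl fun s _ => by ring

theorem diagMatrix_inv_mul {n : ℕ} {c : Fin n → ℂ} (hc : ∀ l, c l ≠ 0) :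
    diagMatrix (fun l => (c l)⁻¹) * diagMatrix c = 1 := by
  rw [diagMatrix_mul, ← diagMatrix_one]
  simp [hc]

/-- The inner product of forms is invariant under pullback along complex diagonal maps. -/
theorem formInner_pullback {n k : ℕ} (h : Matrix (Fin n) (Fin n) ℂ) {c : Fin n → ℂ}
    (hc : ∀ l, c l ≠ 0) (ψ η : Alt n k) :
    formInner (Matrix.of fun j k => h j k * c j * (starRingEnd ℂ) (c k))
      (ψ.compContinuousLinearMap (diagMap c)) (η.compContinuousLinearMap (diagMap c)) =
      formInner h ψ η := by
  classical
  set B := diagMatrix c with hB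
  set M := (realGram (Matrix.of fun j k => h j k * c j * (starRingEnd ℂ) (c k)))⁻¹ with hM
  -- The inverse Gram matrix transforms contragrediently, so it absorbs the matrices `B` that the
  -- coefficients of the pulled back forms produce.
  have hinv : (realGram h)⁻¹ = B * M * B.transpose := by
    have h1 : diagMatrix (fun l => (c l)⁻¹) * B = 1 := diagMatrix_inv_mul hc
    have h2 : B * diagMatrix (fun l => (c l)⁻¹) = 1 := mul_eq_one_comm.1 h1
    have h3 : B * B⁻¹ = 1 := by rw [Matrix.inv_eq_right_inv h2, h2]
    have h4 : B.transpose⁻¹ * B.transpose = 1 := by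
      rw [← Matrix.transpose_nonsing_inv, ← Matrix.transpose_mul, h3, Matrix.transpose_one]
    rw [hM, realGram_pullback, Matrix.mul_inv_rev, Matrix.mul_inv_rev, ← hB, ← mul_assoc,
      ← mul_assoc, h3, one_mul, mul_assoc, h4, mul_one]
  have hexp : ∀ (ψ : Alt n k) (a : Fin k → Fin n × Fin 2),
      ψ.compContinuousLinearMap (diagMap c) (fun i => realBasis (a i)) =
        ∑ p : Fin k → Fin n × Fin 2, (∏ i, (B (p i) (a i) : ℂ)) * ψ fun i => realBasis (p i) :=
    fun ψ a => apply_eq_sum_realCoord ψ _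
  have hprod : ∀ p q : Fin k → Fin n × Fin 2, (∏ i, (((realGram h)⁻¹ (p i) (q i) : ℝ) : ℂ)) =
      ∑ a : Fin k → Fin n × Fin 2, ∑ b : Fin k → Fin n × Fin 2,
        (∏ i, (B (p i) (a i) : ℂ)) * (∏ i, ((M (a i) (b i) : ℝ) : ℂ)) *
          ∏ i, (B (q i) (b i) : ℂ) := by
    intro p q
    have : ∀ i, (((realGram h)⁻¹ (p i) (q i) : ℝ) : ℂ) =
        ∑ a, ∑ b, (B (p i) a : ℂ) * ((M a b : ℝ) : ℂ) * (B (q i) b : ℂ) := by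
      intro i
      rw [hinv]
      simp only [Matrix.mul_apply, Matrix.transpose_apply, Finset.sum_mul]
      push_cast
      exact Finset.sum_comm
    simp only [this, Finset.prod_univ_sum, Fintype.piFinset_univ, ← Finset.prod_mul_distrib]
  rw [formInner, formInner, ← hM]
  congr 1
  -- Both inner products expand to the fourfold sum of `F`: one by expanding the pulled back forms,
  -- the other by expanding the inverse Gram matrix.
  let F (p q a b : Fin k → Fin n × Fin 2) : ℂ :=
    (∏ i, (B (p i) (a i) : ℂ)) * (∏ i, ((M (a i) (b i) : ℝ) : ℂ)) * (∏ i, (B (q i) (b i) : ℂ)) *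
      ψ (fun i => realBasis (p i)) * (starRingEnd ℂ) (η fun i => realBasis (q i))
  trans ∑ a, ∑ b, ∑ p, ∑ q, F p q a b
  · refine Finset.sum_congr rfl fun a _ => Finset.sum_congr rfl fun b _ => ?_
    simp only [hexp, map_sum, map_mul, map_prod, Complex.conj_ofReal]
    rw [mul_assoc, Finset.sum_mul_sum, Finset.mul_sum]
    refine Finset.sum_congr rfl fun p _ => ?_
    rw [Finset.mul_sum]
    exact Finset.sum_congr rfl fun q _ => by simp only [F]; ring
  trans ∑ p, ∑ q, ∑ a, ∑ b, F p q a b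
  · calc ∑ a, ∑ b, ∑ p, ∑ q, F p q a b
        = ∑ a, ∑ p, ∑ q, ∑ b, F p q a b := Finset.sum_congr rfl fun a _ => by
          rw [Finset.sum_comm]
          exact Finset.sum_congr rfl fun p _ => Finset.sum_comm
      _ = ∑ p, ∑ q, ∑ a, ∑ b, F p q a b := by
          rw [Finset.sum_comm]
          exact Finset.sum_congr rfl fun p _ => Finset.sum_comm
  · refine Finset.sum_congr rfl fun p _ => Finset.sum_congr rfl fun q _ => ?_
    rw [hprod, Finset.sum_mul, Finset.sum_mul]
    refine Finset.sum_congr rfl fun a _ => ?_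
    rw [Finset.sum_mul, Finset.sum_mul]

/-! ### Wirtinger derivatives -/

section Wirtinger

variable {n : ℕ} {F G : Type*} [NormedAddCommGroup F] [NormedSpace ℝ F] [NormedSpace ℂ F]
  [NormedAddCommGroup G] [NormedSpace ℝ G] [NormedSpace ℂ G]

/-- The derivative `(∂ψ/∂x_j + s ∂ψ/∂y_j) / 2`; this is `∂ψ/∂z_j` for `s = -i` and `∂ψ/∂z̄_j` for
`s = i`. -/
def wirtinger (s : ℂ) (j : Fin n) (ψ : Cn n → F) (u : Cn n) : F :=
  (1 / 2 : ℂ) • (fderiv ℝ ψ u (realBasis (j, 0)) + s • fderiv ℝ ψ u (realBasis (j, 1)))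

theorem wirtinger_congr (s : ℂ) (j : Fin n) {ψ η : Cn n → F} {u : Cn n} (h : ψ =ᶠ[nhds u] η) :
    wirtinger s j ψ u = wirtinger s j η u := by
  simp only [wirtinger, h.fderiv_eq]

theorem wirtinger_clm [IsScalarTower ℝ ℂ F] [IsScalarTower ℝ ℂ G] (s : ℂ) (j : Fin n)
    (L : F →L[ℂ] G) {ψ : Cn n → F} {u : Cn n}
    (h : DifferentiableAt ℝ ψ u) :
    wirtinger s j (fun w => L (ψ w)) u = L (wirtinger s j ψ u) := by
  have : fderiv ℝ (fun w => L (ψ w)) u = (L.restrictScalars ℝ).comp (fderiv ℝ ψ u) :=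
    ((L.restrictScalars ℝ).hasFDerivAt.comp u h.hasFDerivAt).fderiv
  simp [wirtinger, this]

theorem wirtinger_smul [IsScalarTower ℝ ℂ F] (s : ℂ) (j : Fin n) {f : Cn n → ℂ} {ψ : Cn n → F}
    {u : Cn n}
    (hf : DifferentiableAt ℝ f u) (h : DifferentiableAt ℝ ψ u) :
    wirtinger s j (fun w => f w • ψ w) u =
      f u • wirtinger s j ψ u + wirtinger s j f u • ψ u := by
  have : fderiv ℝ (fun w => f w • ψ w) u = _ := (hf.hasFDerivAt.smul h.hasFDerivAt).fderiv
  simp only [wirtinger, this, add_apply, smul_apply,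
    ContinuousLinearMap.smulRight_apply, smul_eq_mul]
  module

theorem wirtinger_comm [IsScalarTower ℝ ℂ F] (s t : ℂ) (j k : Fin n) {ψ : Cn n → F} {u : Cn n}
    (h : ContDiffAt ℝ ∞ ψ u) :
    wirtinger s j (wirtinger t k ψ) u = wirtinger t k (wirtinger s j ψ) u := by
  have hd2 : DifferentiableAt ℝ (fderiv ℝ ψ) u :=
    (h.fderiv_right (m := 1) (by norm_cast)).differentiableAt (by simp)
  have hsymm : ∀ x y, fderiv ℝ (fderiv ℝ ψ) u x y = fderiv ℝ (fderiv ℝ ψ) u y x :=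
    fun x y => h.isSymmSndFDerivAt (by simp; norm_cast) x y
  have key : ∀ (t : ℂ) (k : Fin n) (v : Cn n), fderiv ℝ (wirtinger t k ψ) u v =
      (1 / 2 : ℂ) • (fderiv ℝ (fderiv ℝ ψ) u v (realBasis (k, 0)) +
        t • fderiv ℝ (fderiv ℝ ψ) u v (realBasis (k, 1))) := by
    intro t k v
    have h1 : ∀ w : Cn n, HasFDerivAt (fun y => fderiv ℝ ψ y w)
        ((fderiv ℝ (fderiv ℝ ψ) u).flip w) u := fun w => by
      simpa using hd2.hasFDerivAt.clm_apply (hasFDerivAt_const w u)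
    have h2 := ((h1 (realBasis (k, 0))).add ((h1 (realBasis (k, 1))).const_smul t)).const_smul
      (1 / 2 : ℂ)
    have h3 : fderiv ℝ (wirtinger t k ψ) u = _ := h2.fderiv
    rw [h3]
    rfl
  simp only [wirtinger, key, hsymm (realBasis (j, 0)), hsymm (realBasis (j, 1))]
  module

theorem contDiffAt_wirtinger [IsScalarTower ℝ ℂ F] {s : ℂ} {j : Fin n} {ψ : Cn n → F} {u : Cn n}
    (h : ContDiffAt ℝ ∞ ψ u) : ContDiffAt ℝ ∞ (wirtinger s j ψ) u := by
  have h1 : ContDiffAt ℝ ∞ (fderiv ℝ ψ) u := h.fderiv_right (by simp)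
  exact ((h1.clm_apply contDiffAt_const).add
    ((h1.clm_apply contDiffAt_const).const_smul s)).const_smul (1 / 2 : ℂ)

theorem wirtinger_eq_zero {s : ℂ} {j : Fin n} {ψ : Cn n → F} {u : Cn n}
    (h : ∀ t, fderiv ℝ ψ u (realBasis (j, t)) = 0) : wirtinger s j ψ u = 0 := by
  simp [wirtinger, h]

/-- A function of the `l`-th coordinate is annihilated by the derivatives in the other
coordinates. -/
theorem wirtinger_comp_eval {s : ℂ} {j l : Fin n} (hjl : j ≠ l) {f : ℂ → F} {u : Cn n}
    (hf : DifferentiableAt ℝ f (u l)) : wirtinger s j (fun w => f (w l)) u = 0 := by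
  refine wirtinger_eq_zero fun t => ?_
  have : HasFDerivAt (fun w : Cn n => f (w l)) ((fderiv ℝ f (u l)).comp (dz l)) u :=
    hf.hasFDerivAt.comp u (dz l).hasFDerivAt
  rw [this.fderiv, ContinuousLinearMap.comp_apply, dz_realBasis, if_neg hjl, map_zero]

end Wirtinger

theorem xiLocal_eq_wirtinger {n k : ℕ} (j : Fin n) (ψ : Cn n → Alt n k) (u : Cn n) :
    xiLocal j ψ u = wedgeLeft (dz j) (wirtinger (-Complex.I) j ψ u) := by
  rw [xiLocal, dDz, wirtinger, sub_eq_add_neg, neg_smul]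

theorem xibarLocal_eq_wirtinger {n k : ℕ} (j : Fin n) (ψ : Cn n → Alt n k) (u : Cn n) :
    xibarLocal j ψ u = wedgeLeft (dzbar j) (wirtinger Complex.I j ψ u) := rfl

theorem xiLocal_congr {n k : ℕ} (j : Fin n) {ψ η : Cn n → Alt n k} {u : Cn n}
    (h : ψ =ᶠ[nhds u] η) : xiLocal j ψ u = xiLocal j η u := by
  rw [xiLocal_eq_wirtinger, xiLocal_eq_wirtinger, wirtinger_congr _ _ h]

theorem xibarLocal_congr {n k : ℕ} (j : Fin n) {ψ η : Cn n → Alt n k} {u : Cn n}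
    (h : ψ =ᶠ[nhds u] η) : xibarLocal j ψ u = xibarLocal j η u := by
  rw [xibarLocal_eq_wirtinger, xibarLocal_eq_wirtinger, wirtinger_congr _ _ h]

/-- The two Wirtinger derivatives commute, and each commutes with a constant wedge; the sign comes
from exchanging `dz_j` and `dz̄_l`. -/
theorem xiLocal_xibarLocal {n k : ℕ} (j l : Fin n) {ψ : Cn n → Alt n k} {u : Cn n}
    (h : ContDiffAt ℝ ∞ ψ u) :
    xiLocal j (xibarLocal l ψ) u = -xibarLocal l (xiLocal j ψ) u := by
  have h1 : xibarLocal l ψ = fun w => wedgeCLM (dzbar l) k (wirtinger Complex.I l ψ w) := rfl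
  have h2 : xiLocal j ψ = fun w => wedgeCLM (dz j) k (wirtinger (-Complex.I) j ψ w) :=
    funext fun w => xiLocal_eq_wirtinger j ψ w
  rw [xiLocal_eq_wirtinger, xibarLocal_eq_wirtinger, h1, h2,
    wirtinger_clm _ _ _ ((contDiffAt_wirtinger h).differentiableAt (by simp)),
    wirtinger_clm _ _ _ ((contDiffAt_wirtinger h).differentiableAt (by simp)),
    wirtinger_comm _ _ _ _ h,
    wedgeCLM_apply, wedgeCLM_apply, wedgeLeft_wedgeLeft]

/-! ### Changes of charts -/

section Charts

variable {n : ℕ} {X : Type*} [TopologicalSpace X] [ChartedSpace (Cn n) X]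

/-- Commuting with the coordinate projections (`c = 1`) forces a diagonal differential; commuting
with `c` times a projection makes each diagonal entry complex linear. -/
theorem DiagonalAt.exists_eq_diagMap {φ : Cn n → Cn n} {u : Cn n} (h : DiagonalAt φ u) :
    ∃ c : Fin n → ℂ, fderiv ℝ φ u = diagMap c := by
  refine ⟨fun l => fderiv ℝ φ u (realBasis (l, 0)) l, ?_⟩
  ext v l
  have h1 := congrFun (h.2.self_of_nhds l 1 v) l
  have h2 := congrFun (h.2.self_of_nhds l (v l) (realBasis (l, 0))) l
  have h3 : coordMap l 1 v = coordMap l (v l) (realBasis (l, 0)) := by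
    simp [coordMap_apply, realBasis]
  rw [h3, h2] at h1
  simp only [coordMap_apply, Pi.single_eq_same, one_mul] at h1
  rw [← h1, diagMap_apply, mul_comm]

theorem mem_transition_source {e e' : RigidChart n X} {u : Cn n} :
    u ∈ (transition e.1 e'.1).source ↔ u ∈ e.1.target ∧ e.1.symm u ∈ e'.1.source := by
  simp

/-- The entries are nonzero by the chain rule for the transition map and its inverse. -/
theorem RigidChart.exists_fderiv_transition (e e' : RigidChart n X) {u : Cn n}
    (hu : u ∈ (transition e.1 e'.1).source) :
    ∃ c : Fin n → ℂ, (∀ l, c l ≠ 0) ∧ fderiv ℝ (transition e.1 e'.1) u = diagMap c := by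
  have h := RigidChart.diagonalAt e e' hu
  obtain ⟨c, hc⟩ := h.exists_eq_diagMap
  have hu' : transition e.1 e'.1 u ∈ (transition e'.1 e.1).source := by
    rw [mem_transition_source] at hu ⊢
    simp [hu.1, hu.2]
  have h' := RigidChart.diagonalAt e' e hu'
  obtain ⟨c', hc'⟩ := h'.exists_eq_diagMap
  refine ⟨c, fun l hl => ?_, hc⟩
  have hid : transition e'.1 e.1 ∘ transition e.1 e'.1 =ᶠ[nhds u] id := by
    filter_upwards [(transition e.1 e'.1).open_source.mem_nhds hu] with y hy
    rw [mem_transition_source] at hy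
    simp [hy.1, hy.2]
  have h1 := fderiv_comp u (h'.1.differentiableAt (by simp)) (h.1.differentiableAt (by simp))
  rw [hid.fderiv_eq, fderiv_id, hc, hc'] at h1
  have h2 := congrFun (congrArg (fun T => T (realBasis (l, 0))) h1) l
  simp [hl, realBasis] at h2

/-! ### Forms given by local expressions -/

/-- The form with prescribed local expressions. -/
def ofLocal {k : ℕ} (T : RigidChart n X → Cn n → Alt n k)
    (h1 : ∀ e, ContDiffOn ℝ ∞ (T e) e.1.target)
    (h2 : ∀ e e' : RigidChart n X, ∀ u ∈ (transition e.1 e'.1).source,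
      T e u = (T e' (transition e.1 e'.1 u)).compContinuousLinearMap
        (fderiv ℝ (transition e.1 e'.1) u)) : DiffForm n X k :=
  ⟨fun e => e.1.target.indicator (T e),
    fun e => (h1 e).congr fun _ hu => Set.indicator_of_mem hu _,
    fun e e' u hu => by
      dsimp only
      rw [Set.indicator_of_mem (show u ∈ e.1.target from hu.1),
        Set.indicator_of_mem (show transition e.1 e'.1 u ∈ e'.1.target from e'.1.map_source hu.2),
        h2 e e' u hu],
    fun _ _ hu => Set.indicator_of_notMem hu _⟩

theorem ofLocal_apply {k : ℕ} (T : RigidChart n X → Cn n → Alt n k) (h1 h2) {e : RigidChart n X}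
    {u : Cn n} (hu : u ∈ e.1.target) : (ofLocal T h1 h2).1 e u = T e u :=
  Set.indicator_of_mem hu _

namespace DiffForm

theorem contDiffAt {k : ℕ} (ψ : DiffForm n X k) {e : RigidChart n X} {u : Cn n}
    (hu : u ∈ e.1.target) : ContDiffAt ℝ ∞ (ψ.1 e) u :=
  (ψ.2.1 e).contDiffAt (e.1.open_target.mem_nhds hu)

theorem differentiableAt {k : ℕ} (ψ : DiffForm n X k) {e : RigidChart n X} {u : Cn n}
    (hu : u ∈ e.1.target) : DifferentiableAt ℝ (ψ.1 e) u :=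
  (contDiffAt ψ hu).differentiableAt (by simp)

theorem ext_target {k : ℕ} {ψ η : DiffForm n X k}
    (h : ∀ e : RigidChart n X, ∀ u ∈ e.1.target, ψ.1 e u = η.1 e u) : ψ = η := by
  refine Subtype.ext (funext fun e => funext fun u => ?_)
  by_cases hu : u ∈ e.1.target
  · exact h e u hu
  · rw [ψ.2.2.2 e u hu, η.2.2.2 e u hu]

/-- Two forms agree if at every point they agree in some chart. -/
theorem ext_chart {k : ℕ} {ψ η : DiffForm n X k}
    (h : ∀ x : X, ∃ e : RigidChart n X, x ∈ e.1.source ∧ ψ.1 e (e.1 x) = η.1 e (e.1 x)) :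
    ψ = η := by
  refine ext_target fun e u hu => ?_
  obtain ⟨e', he', h'⟩ := h (e.1.symm u)
  have hu' : u ∈ (transition e.1 e'.1).source := mem_transition_source.2 ⟨hu, he'⟩
  rw [ψ.2.2.1 e e' u hu', η.2.2.1 e e' u hu']
  exact congrArg (fun α => ContinuousAlternatingMap.compContinuousLinearMap α _) h'

end DiffForm

theorem xi_apply (j : Fin n) {k : ℕ} (ψ : DiffForm n X k) {e : RigidChart n X} {u : Cn n}
    (hu : u ∈ e.1.target) : (xi X j k ψ).1 e u = xiLocal j (ψ.1 e) u :=
  Set.indicator_of_mem hu _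

theorem xi_eventuallyEq (j : Fin n) {k : ℕ} (ψ : DiffForm n X k) {e : RigidChart n X} {u : Cn n}
    (hu : u ∈ e.1.target) : (xi X j k ψ).1 e =ᶠ[nhds u] xiLocal j (ψ.1 e) :=
  Filter.eventually_of_mem (e.1.open_target.mem_nhds hu) fun _ hy => xi_apply j ψ hy

end Charts

/-- The operator on forms with prescribed local expressions. -/
def ofLocalOp {n : ℕ} {X : Type*} [TopologicalSpace X] [ChartedSpace (Cn n) X] {k l : ℕ}
    (T : RigidChart n X → (Cn n → Alt n k) → Cn n → Alt n l)
    (h1 : ∀ (ψ : DiffForm n X k) (e), ContDiffOn ℝ ∞ (T e (ψ.1 e)) e.1.target)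
    (h2 : ∀ (ψ : DiffForm n X k) (e e' : RigidChart n X), ∀ u ∈ (transition e.1 e'.1).source,
      T e (ψ.1 e) u = (T e' (ψ.1 e') (transition e.1 e'.1 u)).compContinuousLinearMap
        (fderiv ℝ (transition e.1 e'.1) u))
    (hadd : ∀ (ψ η : DiffForm n X k) (e : RigidChart n X), ∀ u ∈ e.1.target,
      T e (ψ.1 e + η.1 e) u = T e (ψ.1 e) u + T e (η.1 e) u)
    (hsmul : ∀ (c : ℂ) (ψ : DiffForm n X k) (e : RigidChart n X), ∀ u ∈ e.1.target,
      T e (c • ψ.1 e) u = c • T e (ψ.1 e) u) :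
    DiffForm n X k →ₗ[ℂ] DiffForm n X l where
  toFun ψ := ofLocal (fun e => T e (ψ.1 e)) (h1 ψ) (h2 ψ)
  map_add' ψ η := DiffForm.ext_target fun e u hu =>
    (ofLocal_apply _ _ _ hu).trans <| (hadd ψ η e u hu).trans <|
      congrArg₂ (· + ·) (ofLocal_apply _ (h1 ψ) (h2 ψ) hu).symm
        (ofLocal_apply _ (h1 η) (h2 η) hu).symm
  map_smul' c ψ := DiffForm.ext_target fun e u hu =>
    (ofLocal_apply _ _ _ hu).trans <| (hsmul c ψ e u hu).trans <|
      congrArg (c • ·) (ofLocal_apply _ (h1 ψ) (h2 ψ) hu).symm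

theorem ofLocalOp_apply {n : ℕ} {X : Type*} [TopologicalSpace X] [ChartedSpace (Cn n) X] {k l : ℕ}
    (T : RigidChart n X → (Cn n → Alt n k) → Cn n → Alt n l) (h1 h2 h3 h4)
    (ψ : DiffForm n X k) {e : RigidChart n X} {u : Cn n} (hu : u ∈ e.1.target) :
    (ofLocalOp T h1 h2 h3 h4 ψ).1 e u = T e (ψ.1 e) u :=
  Set.indicator_of_mem hu _

/-! ### The operators `ξ̄_j` -/

/-- The local expression of `ξ_j + ξ̄_j`. -/
theorem xiLocal_add_xibarLocal {n k : ℕ} (j : Fin n) (ψ : Cn n → Alt n k) (u : Cn n) :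
    xiLocal j ψ u + xibarLocal j ψ u =
      ContinuousAlternatingMap.alternatizeUncurryFin ((fderiv ℝ ψ u).comp (coordMap j 1)) := by
  have h : ∀ v : Cn n, coordMap j 1 v =
      (v j).re • realBasis (j, 0) + (v j).im • realBasis (j, 1) := by
    intro v
    ext l
    by_cases hl : l = j
    · subst hl
      apply Complex.ext <;> simp [coordMap_apply, realBasis]
    · simp [coordMap_apply, realBasis, hl]
  ext v
  rw [ContinuousAlternatingMap.add_apply, xiLocal, xibarLocal, wedgeLeft_apply, wedgeLeft_apply,
    ContinuousAlternatingMap.alternatizeUncurryFin_apply, ← Finset.sum_add_distrib]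
  refine Finset.sum_congr rfl fun i _ => ?_
  simp only [ContinuousLinearMap.comp_apply, h, map_add, map_smul, dDz, dDzbar,
    ContinuousAlternatingMap.add_apply, ContinuousAlternatingMap.smul_apply,
    ContinuousAlternatingMap.sub_apply, smul_eq_mul]
  generalize (fderiv ℝ ψ u (realBasis (j, 0))) (i.removeNth v) = A
  generalize (fderiv ℝ ψ u (realBasis (j, 1))) (i.removeNth v) = B
  have h1 : dz j (v i) = v i j := rfl
  have h2 : dzbar j (v i) = (starRingEnd ℂ) (v i j) := rfl
  rw [h1, h2]
  generalize v i j = z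
  simp only [zsmul_eq_mul, Complex.real_smul, Int.cast_pow, Int.cast_neg, Int.cast_one]
  rw [← mul_add]
  congr 1
  have hz : z = z.re + z.im * Complex.I := (Complex.re_add_im z).symm
  have hz' : (starRingEnd ℂ) z = z.re - z.im * Complex.I := by
    apply Complex.ext <;> simp
  rw [hz']
  conv_lhs => rw [hz]
  simp only [Complex.add_re, Complex.ofReal_re, Complex.mul_re, Complex.I_re, Complex.ofReal_im,
    Complex.I_im, Complex.add_im, Complex.mul_im]
  ring_nf
  simp

/-- The sum `ξ_j + ξ̄_j` differentiates along the real projection to the `j`-th axis, which commutes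
with diagonal differentials, so the sum is natural; subtracting the naturality of `ξ_j` leaves that
of `ξ̄_j`. -/
theorem xibarLocal_pullback {n k : ℕ} (j : Fin n) {ψ : Cn n → Alt n k} {φ : Cn n → Cn n}
    {u : Cn n} (hψ : DifferentiableAt ℝ ψ (φ u)) (hφ : DiagonalAt φ u) :
    xibarLocal j (fun y => (ψ (φ y)).compContinuousLinearMap (fderiv ℝ φ y)) u =
      (xibarLocal j ψ (φ u)).compContinuousLinearMap (fderiv ℝ φ u) := by
  have hd : DifferentiableAt ℝ φ u := hφ.1.differentiableAt (by simp)
  have hd2 : DifferentiableAt ℝ (fderiv ℝ φ) u :=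
    (hφ.1.fderiv_right (m := 1) (by norm_cast)).differentiableAt (by simp)
  have hsymm : ∀ x y, fderiv ℝ (fderiv ℝ φ) u x y = fderiv ℝ (fderiv ℝ φ) u y x :=
    fun x y => hφ.1.isSymmSndFDerivAt (by simp; norm_cast) x y
  have hcomm : ∀ a v : Cn n, fderiv ℝ (fderiv ℝ φ) u a (coordMap j 1 v) =
      coordMap j 1 (fderiv ℝ (fderiv ℝ φ) u a v) := by
    intro a v
    have h1 : (fun y => fderiv ℝ φ y (coordMap j 1 v)) =ᶠ[nhds u]
        fun y => coordMap j 1 (fderiv ℝ φ y v) := hφ.2.mono fun y hy => hy j 1 v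
    have h2 := hd2.hasFDerivAt.clm_apply (hasFDerivAt_const (coordMap j 1 v) u)
    have h3 := (coordMap j 1).hasFDerivAt.comp u
      (hd2.hasFDerivAt.clm_apply (hasFDerivAt_const v u))
    have h4 := h2.unique (h3.congr_of_eventuallyEq h1)
    simpa using congrArg (fun T => T a) h4
  have hpart : ContinuousAlternatingMap.alternatizeUncurryFin
      ((fderiv ℝ (fun y => (ψ (φ y)).compContinuousLinearMap (fderiv ℝ φ y)) u).comp
        (coordMap j 1)) =
      (ContinuousAlternatingMap.alternatizeUncurryFin
        ((fderiv ℝ ψ (φ u)).comp (coordMap j 1))).compContinuousLinearMap (fderiv ℝ φ u) := by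
    rw [fderiv_continuousAlternatingMapCompContinuousLinearMap
        (f := fun y => ψ (φ y)) (hψ.comp u hd) hd2,
      ContinuousLinearMap.add_comp, ContinuousAlternatingMap.alternatizeUncurryFin_add,
      ContinuousLinearMap.comp_assoc, ContinuousLinearMap.comp_assoc,
      ContinuousAlternatingMap.alternatizeUncurryFin_fderivCompContinuousLinearMap_eq_zero,
      add_zero, fderiv_fun_comp _ hψ hd]
    · ext v
      simp +unfoldPartialApp [ContinuousAlternatingMap.alternatizeUncurryFin_apply,
        Fin.removeNth, Function.comp_def, hφ.2.self_of_nhds j 1]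
    -- The second derivative of `φ` is symmetric and its values commute with the projection `P`,
    -- hence `D²φ(P x, y) = P D²φ(x, y) = D²φ(P y, x)`. Alternatization kills the term that contains
    -- it.
    · intro x y
      simp only [ContinuousLinearMap.comp_apply]
      rw [hsymm, hcomm, hsymm, ← hcomm, hsymm]
  rw [← xiLocal_add_xibarLocal, ← xiLocal_add_xibarLocal, xiLocal_pullback j hψ hφ] at hpart
  exact add_left_cancel hpart

section Operators

variable {n : ℕ} {X : Type*} [TopologicalSpace X] [ChartedSpace (Cn n) X]

theorem DiffForm.eventuallyEq_pullback {k : ℕ} (ψ : DiffForm n X k) (e e' : RigidChart n X)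
    {u : Cn n} (hu : u ∈ (transition e.1 e'.1).source) :
    ψ.1 e =ᶠ[nhds u] fun y => (ψ.1 e' (transition e.1 e'.1 y)).compContinuousLinearMap
      (fderiv ℝ (transition e.1 e'.1) y) :=
  Filter.eventually_of_mem ((transition e.1 e'.1).open_source.mem_nhds hu) (ψ.2.2.1 e e')

theorem contDiffOn_xibarLocal {k : ℕ} (j : Fin n) {ψ : Cn n → Alt n k} {U : Set (Cn n)}
    (hU : IsOpen U) (hψ : ContDiffOn ℝ ∞ ψ U) : ContDiffOn ℝ ∞ (xibarLocal j ψ) U := fun u hu => by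
  have h := contDiffAt_wirtinger (s := Complex.I) (j := j) (hψ.contDiffAt (hU.mem_nhds hu))
  exact (((wedgeCLM (dzbar j) k).restrictScalars ℝ).contDiff.contDiffAt.comp u
    h).contDiffWithinAt

variable (X) in
/-- The operator `ξ̄_j`, which is `dz̄_j ∧ ∂/∂z̄_j` in each chart. -/
def xibar (j : Fin n) (k : ℕ) : DiffForm n X k →ₗ[ℂ] DiffForm n X (k + 1) :=
  ofLocalOp (fun _ => xibarLocal j)
    (fun ψ e => contDiffOn_xibarLocal j e.1.open_target (ψ.2.1 e))
    (fun ψ e e' u hu => by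
      rw [xibarLocal_congr j (DiffForm.eventuallyEq_pullback ψ e e' hu)]
      exact xibarLocal_pullback j (DiffForm.differentiableAt ψ (e'.1.map_source hu.2))
        (RigidChart.diagonalAt e e' hu))
    (fun ψ η e u hu => by
      simp only [xibarLocal_eq_wirtinger]
      rw [← wedgeLeft_add]
      congr 1
      simp only [wirtinger]
      rw [fderiv_add (DiffForm.differentiableAt ψ hu) (DiffForm.differentiableAt η hu)]
      simp only [add_apply]
      module)
    (fun c ψ e u hu => by
      simp only [xibarLocal_eq_wirtinger]
      rw [← wedgeCLM_apply, ← wedgeCLM_apply, ← map_smul]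
      congr 1
      simp only [wirtinger]
      rw [fderiv_const_smul (DiffForm.differentiableAt ψ hu)]
      simp only [smul_apply]
      module)

theorem xibar_apply (j : Fin n) {k : ℕ} (ψ : DiffForm n X k) {e : RigidChart n X} {u : Cn n}
    (hu : u ∈ e.1.target) : (xibar X j k ψ).1 e u = xibarLocal j (ψ.1 e) u :=
  Set.indicator_of_mem hu _

theorem xibar_eventuallyEq (j : Fin n) {k : ℕ} (ψ : DiffForm n X k) {e : RigidChart n X}
    {u : Cn n} (hu : u ∈ e.1.target) : (xibar X j k ψ).1 e =ᶠ[nhds u] xibarLocal j (ψ.1 e) :=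
  Filter.eventually_of_mem (e.1.open_target.mem_nhds hu) fun _ hy => xibar_apply j ψ hy

/-- `ξ_j ξ̄_l = -ξ̄_l ξ_j`. -/
theorem xi_xibar (j l : Fin n) {k : ℕ} (ψ : DiffForm n X k) :
    xi X j (k + 1) (xibar X l k ψ) = (-1 : ℂ) • xibar X l (k + 1) (xi X j k ψ) :=
  DiffForm.ext_target fun e u hu => by
    rw [xi_apply j _ hu, xiLocal_congr j (xibar_eventuallyEq l ψ hu), Submodule.coe_smul,
      Pi.smul_apply, Pi.smul_apply, xibar_apply l _ hu,
      xibarLocal_congr l (xi_eventuallyEq j ψ hu),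
      xiLocal_xibarLocal j l (DiffForm.contDiffAt ψ hu)]
    exact (neg_one_smul ℂ _).symm

/-! ### The contraction operators `Λ_j` -/

theorem HermitianMetric.coeff_transition (g : HermitianMetric n X) (e e' : RigidChart n X)
    {u : Cn n} (hu : u ∈ (transition e.1 e'.1).source) {c : Fin n → ℂ}
    (hc : fderiv ℝ (transition e.1 e'.1) u = diagMap c) :
    g.coeff e u = Matrix.of fun j k =>
      g.coeff e' (transition e.1 e'.1 u) j k * c j * (starRingEnd ℂ) (c k) := by
  ext j k
  rw [g.compat e e' u hu j k, hc, Finset.sum_eq_single j, Finset.sum_eq_single k]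
  · simp [realBasis]
  · intro m _ hm
    simp [realBasis, hm]
  · simp
  · intro l _ hl
    simp [realBasis, hl]
  · simp

/-- Multiplication by `c_j` on the `j`-th axis has real determinant `|c_j|²`, which is the factor of
the bivector `∂/∂x_j ∧ ∂/∂y_j`. The coefficient `h_{jj}` acquires the same factor, which makes `Λ_j`
independent of the chart. -/
theorem contract_pullback {k : ℕ} (j : Fin n) (c : Fin n → ℂ) (α : Alt n (k + 2)) :
    contract j k (α.compContinuousLinearMap (diagMap c)) =
      (c j * (starRingEnd ℂ) (c j)) •
        (contract j k α).compContinuousLinearMap (diagMap c) := by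
  ext w
  have h : ∀ t : Fin 2, diagMap c (realBasis (j, t)) =
      (c j * if t = 0 then 1 else Complex.I).re • realBasis (j, 0) +
        (c j * if t = 0 then 1 else Complex.I).im • realBasis (j, 1) := by
    intro t
    ext l
    by_cases hl : l = j
    · subst hl
      apply Complex.ext <;> fin_cases t <;> simp [realBasis]
    · simp [realBasis, hl]
  have hv : diagMap c ∘ (Matrix.vecCons (realBasis (j, 0)) (Matrix.vecCons (realBasis (j, 1)) w) :
      Fin (k + 2) → Cn n) = Matrix.vecCons (diagMap c (realBasis (j, 0)))
        (Matrix.vecCons (diagMap c (realBasis (j, 1))) (diagMap c ∘ w)) := by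
    ext1 l
    refine Fin.cases ?_ (fun l => Fin.cases ?_ (fun l => ?_) l) l <;> simp
  rw [contract_apply, ContinuousAlternatingMap.compContinuousLinearMap_apply, hv,
    ContinuousAlternatingMap.smul_apply, ContinuousAlternatingMap.compContinuousLinearMap_apply,
    contract_apply]
  have hlin : ∀ v v', α (Matrix.vecCons v (Matrix.vecCons v' (diagMap c ∘ w))) =
      (α.curryLeft v).curryLeft v' (diagMap c ∘ w) := fun _ _ => rfl
  rw [hlin, h, h]
  simp only [map_add, map_smul, ContinuousAlternatingMap.curryLeft_add,
    ContinuousAlternatingMap.curryLeft_smul, add_apply, smul_apply,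
    ContinuousAlternatingMap.add_apply, ContinuousAlternatingMap.smul_apply, ← hlin,
    map_vecCons_self, map_vecCons_swap α (realBasis (j, 1)) (realBasis (j, 0)), smul_zero,
    zero_add, add_zero, if_true, if_neg (one_ne_zero : (1 : Fin 2) ≠ 0), Complex.real_smul,
    smul_eq_mul, Complex.mul_conj, Complex.normSq_apply]
  simp
  ring

theorem contDiff_contract (k : ℕ) (j : Fin n) :
    ContDiff ℝ ∞ (contract j k : Alt n (k + 2) → Alt n k) :=
  ((contract j k).restrictScalars ℝ).contDiff

open scoped ComplexOrder in
/-- The operator `Λ_j`, which is the contraction with `h_{jj}⁻¹ ∂/∂x_j ∧ ∂/∂y_j` in each chart. -/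
def HermitianMetric.lambda (g : HermitianMetric n X) (j : Fin n) (k : ℕ) :
    DiffForm n X (k + 2) →ₗ[ℂ] DiffForm n X k :=
  ofLocalOp (fun e ψ u => (g.coeff e u j j)⁻¹ • contract j k (ψ u))
    (fun ψ e => ((g.smooth e j j).inv fun u hu => (g.posDef e u hu).diag_pos.ne').smul
      ((contDiff_contract k j).comp_contDiffOn (ψ.2.1 e)))
    (fun ψ e e' u hu => by
      obtain ⟨c, hc0, hc⟩ := e.exists_fderiv_transition e' hu
      rw [ψ.2.2.1 e e' u hu, hc, contract_pullback, g.coeff_transition e e' hu hc, smul_smul,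
        Matrix.of_apply, mul_assoc, mul_inv, mul_assoc, inv_mul_cancel₀, mul_one]
      · rfl
      · simp [hc0 j])
    (fun ψ η e u _ => by rw [Pi.add_apply, map_add, smul_add])
    (fun c ψ e u _ => by rw [Pi.smul_apply, map_smul, smul_comm])

theorem HermitianMetric.lambda_apply (g : HermitianMetric n X) (j : Fin n) {k : ℕ}
    (ψ : DiffForm n X (k + 2)) {e : RigidChart n X} {u : Cn n} (hu : u ∈ e.1.target) :
    (g.lambda j k ψ).1 e u = (g.coeff e u j j)⁻¹ • contract j k (ψ.1 e u) :=
  ofLocalOp_apply (fun e ψ u => (g.coeff e u j j)⁻¹ • contract j k (ψ u)) _ _ _ _ ψ hu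

end Operators

/-! ### The candidate adjoint and its anticommutation with `ξ_j`. -/

section Adjoint

variable {n : ℕ} {X : Type*} [TopologicalSpace X] [ChartedSpace (Cn n) X]

/-- The operator `i (Λ_j ξ̄_j - ξ̄_j Λ_j)`. -/
def HermitianMetric.adj (g : HermitianMetric n X) (j : Fin n) :
    (m : ℕ) → DiffForm n X (m + 1) →ₗ[ℂ] DiffForm n X m
  | 0 => Complex.I • (g.lambda j 0 ∘ₗ xibar X j 1)
  | m + 1 => Complex.I • (g.lambda j (m + 1) ∘ₗ xibar X j (m + 2)) +
      (-Complex.I) • (xibar X j m ∘ₗ g.lambda j m)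

/-- In the chart `e` the metric is `∑ d_j(z_j) dz_j ⊗ dz̄_j`. -/
structure HermitianMetric.IsDiagonalIn (g : HermitianMetric n X) (e : RigidChart n X)
    (d : Fin n → ℂ → ℝ) : Prop where
  contDiffOn : ∀ j, ContDiffOn ℝ ∞ (d j) ((fun u : Cn n => u j) '' e.1.target)
  coeff_eq : ∀ u ∈ e.1.target, g.coeff e u = Matrix.diagonal fun j => (d j (u j) : ℂ)

/-- Take `d_j = |f_j|²`; the essential point is that it depends on `z_j` alone. -/
theorem HermitianMetric.IsDistinctiveKahler.exists_isDiagonalIn {g : HermitianMetric n X}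
    (hg : g.IsDistinctiveKahler) (x : X) :
    ∃ (e : RigidChart n X) (d : Fin n → ℂ → ℝ), x ∈ e.1.source ∧ g.IsDiagonalIn e d := by
  obtain ⟨e, hx, f, hf, hc, -⟩ := hg x
  refine ⟨e, fun j z => Complex.normSq (f j z), hx, fun j => ?_, fun u hu => ?_⟩
  · have h1 := Complex.reCLM.contDiff.comp_contDiffOn (hf j)
    have h2 := Complex.imCLM.contDiff.comp_contDiffOn (hf j)
    exact (h1.mul h1).add (h2.mul h2)
  · rw [hc u hu]
    simp only [Complex.mul_conj]

namespace HermitianMetric.IsDiagonalIn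

variable {g : HermitianMetric n X} {e : RigidChart n X} {d : Fin n → ℂ → ℝ}

open scoped ComplexOrder in
theorem pos (h : g.IsDiagonalIn e d) {u : Cn n} (hu : u ∈ e.1.target) (j : Fin n) :
    0 < d j (u j) := by
  have := (g.posDef e u hu).diag_pos (i := j)
  rw [h.coeff_eq u hu, Matrix.diagonal_apply_eq] at this
  exact_mod_cast this

theorem contDiffAt (h : g.IsDiagonalIn e d) {u : Cn n} (hu : u ∈ e.1.target) (j : Fin n) :
    ContDiffAt ℝ ∞ (d j) (u j) :=
  (h.contDiffOn j).contDiffAt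
    ((isOpenMap_eval j _ e.1.open_target).mem_nhds ⟨u, hu, rfl⟩)

theorem contDiffAt_coord (h : g.IsDiagonalIn e d) {u : Cn n} (hu : u ∈ e.1.target) (j : Fin n) :
    ContDiffAt ℝ ∞ (fun w : Cn n => (d j (w j) : ℂ)) u :=
  Complex.ofRealCLM.contDiff.contDiffAt.comp u
    ((h.contDiffAt hu j).comp u (dz j).contDiff.contDiffAt)

theorem ne_zero (h : g.IsDiagonalIn e d) {u : Cn n} (hu : u ∈ e.1.target) (j : Fin n) :
    (d j (u j) : ℂ) ≠ 0 :=
  Complex.ofReal_ne_zero.2 (h.pos hu j).ne'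

theorem contDiffAt_coord_inv (h : g.IsDiagonalIn e d) {u : Cn n} (hu : u ∈ e.1.target)
    (j : Fin n) : ContDiffAt ℝ ∞ (fun w : Cn n => (d j (w j) : ℂ)⁻¹) u :=
  (h.contDiffAt_coord hu j).inv (h.ne_zero hu j)

theorem wirtinger_inv_eq_zero (h : g.IsDiagonalIn e d) {u : Cn n} (hu : u ∈ e.1.target) (s : ℂ)
    {j l : Fin n} (hjl : j ≠ l) : wirtinger s j (fun w : Cn n => (d l (w l) : ℂ)⁻¹) u = 0 :=
  wirtinger_comp_eval (f := fun z => (d l z : ℂ)⁻¹) hjl <|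
    ((Complex.ofRealCLM.contDiff.contDiffAt.comp (u l) (h.contDiffAt hu l)).inv
      (h.ne_zero hu l)).differentiableAt (by simp)

theorem lambda_eventuallyEq (h : g.IsDiagonalIn e d) {u : Cn n} (hu : u ∈ e.1.target) (l : Fin n)
    {k : ℕ} (ψ : DiffForm n X (k + 2)) : (g.lambda l k ψ).1 e =ᶠ[nhds u]
      fun w => (d l (w l) : ℂ)⁻¹ • contract l k (ψ.1 e w) := by
  filter_upwards [e.1.open_target.mem_nhds hu] with w hw
  rw [g.lambda_apply l ψ hw, h.coeff_eq w hw, Matrix.diagonal_apply_eq]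

theorem lambda_apply (h : g.IsDiagonalIn e d) {u : Cn n} (hu : u ∈ e.1.target) (l : Fin n)
    {k : ℕ} (ψ : DiffForm n X (k + 2)) :
    (g.lambda l k ψ).1 e u = (d l (u l) : ℂ)⁻¹ • contract l k (ψ.1 e u) :=
  (h.lambda_eventuallyEq hu l ψ).self_of_nhds

/-- Leibniz rule. The second term is the derivative of the metric: it vanishes for `j ≠ l`, and for
`j = l` it gives the zeroth order part of the adjoint. -/
theorem wirtinger_lambda (h : g.IsDiagonalIn e d) {u : Cn n} (hu : u ∈ e.1.target) (s : ℂ)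
    (j l : Fin n) {k : ℕ} (ψ : DiffForm n X (k + 2)) :
    wirtinger s j ((g.lambda l k ψ).1 e) u =
      (d l (u l) : ℂ)⁻¹ • contract l k (wirtinger s j (ψ.1 e) u) +
        wirtinger s j (fun w : Cn n => (d l (w l) : ℂ)⁻¹) u • contract l k (ψ.1 e u) := by
  have hψ := DiffForm.differentiableAt ψ hu
  rw [wirtinger_congr _ _ (h.lambda_eventuallyEq hu l ψ),
    wirtinger_smul s j (ψ := fun w => contract l k (ψ.1 e w))
      ((h.contDiffAt_coord_inv hu l).differentiableAt (by simp))
      (((contract l k).restrictScalars ℝ).differentiableAt.comp u hψ),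
    wirtinger_clm s j (contract l k) hψ]

end HermitianMetric.IsDiagonalIn

/-- `ξ_j` commutes with `Λ_l` for `j ≠ l`. -/
theorem HermitianMetric.IsDistinctiveKahler.xi_lambda {g : HermitianMetric n X}
    (hg : g.IsDistinctiveKahler) {j l : Fin n} (hjl : j ≠ l) {k : ℕ}
    (ψ : DiffForm n X (k + 2)) :
    xi X j k (g.lambda l k ψ) = g.lambda l (k + 1) (xi X j (k + 2) ψ) :=
  DiffForm.ext_chart fun x => by
    obtain ⟨e, d, hx, h⟩ := hg.exists_isDiagonalIn x
    have hu := e.1.map_source hx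
    refine ⟨e, hx, ?_⟩
    rw [xi_apply j _ hu, xiLocal_eq_wirtinger, h.wirtinger_lambda hu, h.lambda_apply hu,
      xi_apply j _ hu, xiLocal_eq_wirtinger, contract_wedgeLeft_dz hjl,
      h.wirtinger_inv_eq_zero hu _ hjl, zero_smul, add_zero, ← wedgeCLM_apply, map_smul,
      wedgeCLM_apply]

/-- Replaces the commutation of `ξ_j` and `Λ_l` in degree one, where `Λ_l ψ` would have negative
degree. -/
theorem HermitianMetric.lambda_xi_one (g : HermitianMetric n X) {j l : Fin n} (hjl : j ≠ l)
    (ψ : DiffForm n X 1) : g.lambda l 0 (xi X j 1 ψ) = 0 :=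
  DiffForm.ext_target fun e u hu => by
    rw [g.lambda_apply l _ hu, xi_apply j _ hu, xiLocal, contract_wedgeLeft_dz_zero hjl]
    exact smul_zero (A := Alt n 0) _

/-- On functions only the term `i Λ_l ξ̄_l ξ_j = -i Λ_l ξ_j ξ̄_l` is present, and `Λ_l ξ_j` kills
1-forms. -/
theorem HermitianMetric.adj_zero_comp_xi (g : HermitianMetric n X) {j l : Fin n} (hjl : j ≠ l) :
    g.adj l 0 ∘ₗ xi X j 0 = 0 := by
  ext1 ψ
  have h : xibar X l 1 (xi X j 0 ψ) = (-1 : ℂ) • xi X j 1 (xibar X l 0 ψ) := by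
    rw [xi_xibar]
    module
  simp only [HermitianMetric.adj, LinearMap.comp_apply, LinearMap.smul_apply, h, map_smul,
    g.lambda_xi_one hjl, LinearMap.zero_apply]
  module

/-- Moving `ξ_j` through `Λ_l` costs no sign and through `ξ̄_l` costs one, so it anticommutes with
both products in `adj`. For `m = 0` the second product is missing from the first summand, and in the
other summand `Λ_l ξ_j ψ = 0`. -/
theorem HermitianMetric.IsDistinctiveKahler.xi_adj_add_adj_xi {g : HermitianMetric n X}
    (hg : g.IsDistinctiveKahler) {j l : Fin n} (hjl : j ≠ l) (m : ℕ) :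
    xi X j m ∘ₗ g.adj l m + g.adj l (m + 1) ∘ₗ xi X j (m + 1) = 0 := by
  ext1 ψ
  cases m with
  | zero =>
    have h1 := g.lambda_xi_one hjl ψ
    simp only [HermitianMetric.adj, LinearMap.add_apply, LinearMap.comp_apply,
      LinearMap.smul_apply, map_smul, LinearMap.zero_apply]
    rw [hg.xi_lambda hjl, xi_xibar, h1, map_smul, map_zero]
    module
  | succ m =>
    simp only [HermitianMetric.adj, LinearMap.add_apply, LinearMap.comp_apply,
      LinearMap.smul_apply, map_smul, map_add, LinearMap.zero_apply]
    rw [hg.xi_lambda hjl, xi_xibar, xi_xibar, map_smul, hg.xi_lambda hjl]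
    module

end Adjoint

/-! ### The divergence identity -/

/-- The evaluation of forms at a tuple of vectors. -/
def evalCLM {n k : ℕ} (v : Fin k → Cn n) : Alt n k →L[ℂ] ℂ where
  toFun α := α v
  map_add' _ _ := rfl
  map_smul' _ _ := rfl
  cont := (ContinuousAlternatingMap.apply ℝ (Cn n) ℂ v).continuous

@[simp] theorem evalCLM_apply {n k : ℕ} (v : Fin k → Cn n) (α : Alt n k) :
    evalCLM v α = α v := rfl

/-- `f` is differentiable at `u` and `∂f/∂z̄_j = f'`. -/
def HasDbar {n : ℕ} (j : Fin n) (f : Cn n → ℂ) (f' : ℂ) (u : Cn n) : Prop :=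
  DifferentiableAt ℝ f u ∧ wirtinger Complex.I j f u = f'

namespace HasDbar

variable {n : ℕ} {j : Fin n} {f f₁ : Cn n → ℂ} {f' f₁' : ℂ} {u : Cn n}

theorem mul (h : HasDbar j f f' u) (h₁ : HasDbar j f₁ f₁' u) :
    HasDbar j (fun w => f w * f₁ w) (f' * f₁ u + f u * f₁') u :=
  ⟨h.1.mul h₁.1, by
    have := wirtinger_smul Complex.I j h.1 h₁.1
    simp only [smul_eq_mul] at this
    rw [this, h.2, h₁.2, add_comm]⟩

theorem const (c : ℂ) : HasDbar j (fun _ => c) 0 u :=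
  ⟨differentiableAt_const _, by simp [wirtinger]⟩

theorem add (h : HasDbar j f f' u) (h₁ : HasDbar j f₁ f₁' u) :
    HasDbar j (fun w => f w + f₁ w) (f' + f₁') u :=
  ⟨h.1.add h₁.1, by
    rw [← h.2, ← h₁.2]
    simp only [wirtinger, fderiv_fun_add h.1 h₁.1, add_apply]
    module⟩

theorem sum {ι : Type*} (s : Finset ι) {f : ι → Cn n → ℂ} {f' : ι → ℂ}
    (h : ∀ i, HasDbar j (f i) (f' i) u) :
    HasDbar j (fun w => ∑ i ∈ s, f i w) (∑ i ∈ s, f' i) u := by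
  classical
  induction s using Finset.induction_on with
  | empty => simpa using const 0
  | insert i s hi ih => simpa only [Finset.sum_insert hi] using (h i).add ih

/-- The derivatives are stated in logarithmic form, `∂f/∂z̄_j = c f`, so that the coefficients of a
product of metric weights add up. -/
theorem prod {ι : Type*} (s : Finset ι) {f : ι → Cn n → ℂ} {c : ι → ℂ}
    (h : ∀ i, HasDbar j (f i) (c i * f i u) u) :
    HasDbar j (fun w => ∏ i ∈ s, f i w) ((∑ i ∈ s, c i) * ∏ i ∈ s, f i u) u := by
  classical
  induction s using Finset.induction_on with
  | empty => simpa using const 1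
  | insert i s hi ih =>
    simp only [Finset.prod_insert hi, Finset.sum_insert hi]
    convert (h i).mul ih using 1
    ring

theorem inv (h : HasDbar j f f' u) (h0 : f u ≠ 0) :
    HasDbar j (fun w => (f w)⁻¹) (-f' / f u ^ 2) u := by
  have hd : DifferentiableAt ℝ (fun w => (f w)⁻¹) u := h.1.inv h0
  have h1 := h.mul ⟨hd, rfl⟩
  have h2 : wirtinger Complex.I j (fun w => f w * (f w)⁻¹) u = 0 := by
    rw [wirtinger_congr (η := fun _ => 1)]
    · exact (const 1).2
    · filter_upwards [h.1.continuousAt.eventually_ne h0] with w hw using mul_inv_cancel₀ hw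
  refine ⟨hd, ?_⟩
  have h3 := h1.2
  rw [h2] at h3
  field_simp at h3 ⊢
  linear_combination -h3

theorem conj {f : Cn n → ℂ} (h : DifferentiableAt ℝ f u) :
    HasDbar j (fun w => (starRingEnd ℂ) (f w))
      ((starRingEnd ℂ) (wirtinger (-Complex.I) j f u)) u := by
  have hd := (Complex.conjCLE : ℂ →L[ℝ] ℂ).hasFDerivAt.comp u h.hasFDerivAt
  refine ⟨hd.differentiableAt, ?_⟩
  have : fderiv ℝ (fun w => (starRingEnd ℂ) (f w)) u = _ := hd.fderiv
  have h2 : (starRingEnd ℂ) 2 = 2 := Complex.conj_ofNat 2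
  simp [wirtinger, this, h2]

end HasDbar

section Divergence

variable {n : ℕ} {X : Type*} [TopologicalSpace X] [ChartedSpace (Cn n) X]

/-- The function `det(h) · (d_l⁻¹ 2 ∂/∂z_l ⌟ ψ, η)` for the metric `∑ d_j(z_j) dz_j ⊗ dz̄_j`. -/
def flux {m : ℕ} (d : Fin n → ℂ → ℝ) (l : Fin n) (ψ : Cn n → Alt n (m + 1)) (η : Cn n → Alt n m)
    (u : Cn n) : ℂ :=
  ∑ a : Fin m → Fin n × Fin 2, 1 / (m.factorial : ℂ) *
    ((∏ j, (d j (u j) : ℂ)) * (∏ i, (d (a i).1 (u (a i).1) : ℂ)⁻¹) * (d l (u l) : ℂ)⁻¹) *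
      (interiorZ l m (ψ u) fun i => realBasis (a i)) *
        (starRingEnd ℂ) (η u fun i => realBasis (a i))

namespace HermitianMetric.IsDiagonalIn

variable {g : HermitianMetric n X} {e : RigidChart n X} {d : Fin n → ℂ → ℝ}

/-- The terms `dz̄_l ∧ contract (∂ψ/∂z̄_l)` of the two products cancel. What remains is `-d_l⁻¹
ι(∂ψ/∂z̄_l)` from the pointwise commutator and the derivative of `d_l⁻¹`, multiplied by the number
of indices equal to `l`. -/
theorem adj_apply_realBasis (h : g.IsDiagonalIn e d) {u : Cn n} (hu : u ∈ e.1.target) (l : Fin n)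
    {m : ℕ} (ψ : DiffForm n X (m + 1)) (a : Fin m → Fin n × Fin 2) :
    (g.adj l m ψ).1 e u (fun i => realBasis (a i)) =
      -(d l (u l) : ℂ)⁻¹ *
          interiorZ l m (wirtinger Complex.I l (ψ.1 e) u) (fun i => realBasis (a i)) -
        wirtinger Complex.I l (fun w : Cn n => (d l (w l) : ℂ)⁻¹) u *
          (∑ i, if (a i).1 = l then (1 : ℂ) else 0) *
            interiorZ l m (ψ.1 e u) (fun i => realBasis (a i)) := by
  cases m with
  | zero =>
    have h1 : (g.adj l 0 ψ).1 e u =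
        Complex.I • (g.lambda l 0 (xibar X l 1 ψ)).1 e u := rfl
    rw [h1, h.lambda_apply hu, xibar_apply l ψ hu, xibarLocal_eq_wirtinger,
      contract_wedgeLeft_dzbar_zero]
    simp only [ContinuousAlternatingMap.smul_apply, smul_eq_mul, Finset.univ_eq_empty,
      Finset.sum_empty]
    linear_combination ((d l (u l) : ℂ)⁻¹ * interiorZ l 0 (wirtinger Complex.I l (ψ.1 e) u)
      (fun i => realBasis (a i))) * Complex.I_mul_I
  | succ m =>
    have h1 : (g.adj l (m + 1) ψ).1 e u =
        Complex.I • (g.lambda l (m + 1) (xibar X l (m + 2) ψ)).1 e u +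
          (-Complex.I) • (xibar X l m (g.lambda l m ψ)).1 e u := rfl
    rw [h1, h.lambda_apply hu, xibar_apply l ψ hu, xibarLocal_eq_wirtinger,
      contract_wedgeLeft_dzbar, xibar_apply l _ hu, xibarLocal_eq_wirtinger,
      h.wirtinger_lambda hu, mul_assoc (wirtinger Complex.I l _ u),
      ← wedgeLeft_dzbar_contract_apply, ← wedgeCLM_apply, ← wedgeCLM_apply, ← wedgeCLM_apply,
      map_add, map_smul, map_smul]
    simp only [ContinuousAlternatingMap.smul_apply, smul_eq_mul,
      ContinuousAlternatingMap.add_apply]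
    linear_combination ((d l (u l) : ℂ)⁻¹ * interiorZ l (m + 1)
      (wirtinger Complex.I l (ψ.1 e) u) (fun i => realBasis (a i))) * Complex.I_mul_I

theorem contDiffAt_flux (h : g.IsDiagonalIn e d) {u : Cn n} (hu : u ∈ e.1.target) (l : Fin n)
    {m : ℕ} (ψ : DiffForm n X (m + 1)) (η : DiffForm n X m) :
    ContDiffAt ℝ ∞ (flux d l (ψ.1 e) (η.1 e)) u := by
  refine ContDiffAt.sum fun a _ => ?_
  refine ((contDiffAt_const.mul (((contDiffAt_prod fun j _ => h.contDiffAt_coord hu j).mul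
    (contDiffAt_prod fun i _ => h.contDiffAt_coord_inv hu _)).mul
      (h.contDiffAt_coord_inv hu l))).mul ?_).mul ?_
  · exact ((evalCLM (fun i => realBasis (a i))).comp
      (interiorZ l m)).restrictScalars ℝ |>.contDiff.contDiffAt.comp u (DiffForm.contDiffAt ψ hu)
  · exact (Complex.conjCLE : ℂ →L[ℝ] ℂ).contDiff.contDiffAt.comp u <|
      ((evalCLM (fun i => realBasis (a i))).restrictScalars ℝ).contDiff.contDiffAt.comp u
        (DiffForm.contDiffAt η hu)

/-- In the weight, the factor `d_l` of `det h` cancels the `d_l⁻¹` belonging to the covector `dz_l`,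
so its logarithmic derivative is `-N κ`, where `N` counts the entries of `a` with index `l`. This
matches the zeroth order term of `adj`. Differentiating `ψ` gives the other term of `adj`, and
differentiating the conjugate of `η` gives `(ψ, dz_l ∧ ∂η/∂z_l)`. -/
theorem wirtinger_flux (h : g.IsDiagonalIn e d) {u : Cn n} (hu : u ∈ e.1.target) (l : Fin n)
    {m : ℕ} (ψ : DiffForm n X (m + 1)) (η : DiffForm n X m) :
    wirtinger Complex.I l (flux d l (ψ.1 e) (η.1 e)) u =
      (g.coeff e u).det * formInner (g.coeff e u) (ψ.1 e u) ((xi X l m η).1 e u) -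
        (g.coeff e u).det * formInner (g.coeff e u) ((g.adj l m ψ).1 e u) (η.1 e u) := by
  set δ := wirtinger Complex.I l (fun w : Cn n => (d l (w l) : ℂ)⁻¹) u with hδ
  -- `κ` is the logarithmic derivative of `d_l` with respect to `z̄_l`, expressed through the
  -- derivative `δ` of `d_l⁻¹`.
  set κ : ℂ := -δ * d l (u l) with hκ
  have hdinv : ∀ j, HasDbar l (fun w : Cn n => (d j (w j) : ℂ)⁻¹)
      ((if j = l then -κ else 0) * (d j (u j) : ℂ)⁻¹) u := fun j => by
    refine ⟨(h.contDiffAt_coord_inv hu j).differentiableAt (by simp), ?_⟩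
    split_ifs with hj
    · subst hj
      rw [← hδ, hκ]
      have := h.ne_zero hu j
      field_simp
    · rw [h.wirtinger_inv_eq_zero hu _ (Ne.symm hj), zero_mul]
  have hd : ∀ j, HasDbar l (fun w : Cn n => (d j (w j) : ℂ))
      ((if j = l then κ else 0) * (d j (u j) : ℂ)) u := fun j => by
    have h0 := h.ne_zero hu j
    have h1 := (hdinv j).inv (inv_ne_zero h0)
    simp only [inv_inv] at h1
    convert h1 using 1
    split_ifs
    · field_simp
    · simp
  have hflux : HasDbar l (flux d l (ψ.1 e) (η.1 e)) _ u := HasDbar.sum Finset.univ fun a =>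
    (((HasDbar.const (1 / (m.factorial : ℂ))).mul
      (((HasDbar.prod Finset.univ hd).mul
        (HasDbar.prod Finset.univ fun i => hdinv (a i).1)).mul (hdinv l))).mul
      (f₁ := fun u => interiorZ l m (ψ.1 e u) fun i => realBasis (a i))
      (f₁' := interiorZ l m (wirtinger Complex.I l (ψ.1 e) u) fun i => realBasis (a i))
      ⟨(((evalCLM (fun i => realBasis (a i))).comp (interiorZ l m)).restrictScalars
          ℝ).differentiableAt.comp u (DiffForm.differentiableAt ψ hu),
        wirtinger_clm Complex.I l ((evalCLM (fun i => realBasis (a i))).comp (interiorZ l m))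
          (DiffForm.differentiableAt ψ hu)⟩).mul
      (HasDbar.conj (f := fun u => η.1 e u fun i => realBasis (a i))
        (((evalCLM (fun i => realBasis (a i))).restrictScalars
          ℝ).differentiableAt.comp u (DiffForm.differentiableAt η hu)))
  have hη : ∀ a : Fin m → Fin n × Fin 2,
      wirtinger (-Complex.I) l (fun u => η.1 e u fun i => realBasis (a i)) u =
        wirtinger (-Complex.I) l (η.1 e) u fun i => realBasis (a i) := fun a =>
    wirtinger_clm (-Complex.I) l (evalCLM fun i => realBasis (a i))
      (DiffForm.differentiableAt η hu)
  have hne : ∀ j, d j (u j) ≠ 0 := fun j => (h.pos hu j).ne'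
  rw [hflux.2, h.coeff_eq u hu, Matrix.det_diagonal, xi_apply l η hu, xiLocal_eq_wirtinger,
    formInner_wedgeLeft_dz hne, formInner_diagonal hne, formInner_diagonal hne]
  simp only [Finset.mul_sum, ← Finset.sum_sub_distrib]
  refine Finset.sum_congr rfl fun a _ => ?_
  rw [h.adj_apply_realBasis hu, ← hδ, hη a]
  have hN : ∑ i, (if (a i).1 = l then -κ else 0) =
      -κ * ∑ i, if (a i).1 = l then (1 : ℂ) else 0 := by
    rw [Finset.mul_sum]
    exact Finset.sum_congr rfl fun i _ => by split_ifs <;> simp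
  have hK : ∑ j, (if j = l then κ else 0) = κ := by simp
  have hδκ : δ = -κ * (d l (u l) : ℂ)⁻¹ := by
    have := h.ne_zero hu l
    rw [hκ]
    field_simp
  rw [hN, hK, hδκ]
  simp only [if_true]
  ring

end HermitianMetric.IsDiagonalIn

end Divergence

/-! ### The volume measure -/

theorem det_diagMap {n : ℕ} (c : Fin n → ℂ) :
    (diagMap c).det = Complex.normSq (∏ l, c l) := by
  have h : ((diagMap c : Cn n →L[ℝ] Cn n) : Cn n →ₗ[ℝ] Cn n) =
      (Matrix.toLin' (Matrix.diagonal c)).restrictScalars ℝ := by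
    ext v l
    simp [Matrix.mulVec_diagonal]
  rw [ContinuousLinearMap.det, h, LinearMap.det_restrictScalars, LinearMap.det_toLin',
    Matrix.det_diagonal, Algebra.norm_complex_apply]

namespace HermitianMetric

variable {n : ℕ} {X : Type*} [TopologicalSpace X] [ChartedSpace (Cn n) X]
  (g : HermitianMetric n X)

/-- The hermitian determinant gains `|∏ c_l|²`, which is also the real Jacobian of the transition
map; so the chart densities define one measure on overlaps. -/
theorem det_coeff_transition (e e' : RigidChart n X) {u : Cn n}
    (hu : u ∈ (transition e.1 e'.1).source) :
    (g.coeff e u).det.re = |(fderiv ℝ (transition e.1 e'.1) u).det| *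
      (g.coeff e' (transition e.1 e'.1 u)).det.re := by
  obtain ⟨c, -, hc⟩ := e.exists_fderiv_transition e' hu
  have h : g.coeff e u = Matrix.diagonal c * g.coeff e' (transition e.1 e'.1 u) *
      Matrix.diagonal fun k => (starRingEnd ℂ) (c k) := by
    rw [g.coeff_transition e e' hu hc]
    ext j k
    simp only [Matrix.of_apply, Matrix.mul_diagonal, Matrix.diagonal_mul]
    ring
  rw [hc, det_diagMap, abs_of_nonneg (Complex.normSq_nonneg _), h, Matrix.det_mul, Matrix.det_mul,
    Matrix.det_diagonal, Matrix.det_diagonal, ← map_prod, mul_right_comm, Complex.mul_conj,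
    Complex.re_ofReal_mul]

open scoped ComplexOrder in
theorem det_coeff_pos (e : RigidChart n X) {u : Cn n} (hu : u ∈ e.1.target) :
    0 < (g.coeff e u).det.re := by
  have := (g.posDef e u hu).det_pos
  exact (Complex.pos_iff.1 this).1

theorem continuousOn_det_coeff (e : RigidChart n X) :
    ContinuousOn (fun u => (g.coeff e u).det.re) e.1.target := by
  refine Complex.continuous_re.comp_continuousOn ?_
  have h : ContinuousOn (g.coeff e) e.1.target :=
    continuousOn_pi.2 fun j => continuousOn_pi.2 fun k => (g.smooth e j k).continuousOn
  exact (continuous_id.matrix_det).comp_continuousOn h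

theorem aemeasurable_density (e : RigidChart n X) :
    AEMeasurable (fun u => ENNReal.ofReal (g.coeff e u).det.re)
      ((volume : Measure (Cn n)).restrict e.1.target) :=
  ((g.continuousOn_det_coeff e).aemeasurable e.1.open_target.measurableSet).ennreal_ofReal

variable [MeasurableSpace X]

/-- The volume measure in a chart. -/
def chartVol (e : RigidChart n X) : Measure X :=
  (((volume : Measure (Cn n)).restrict e.1.target).withDensity
    fun u => ENNReal.ofReal (g.coeff e u).det.re).map e.1.symm

theorem vol_eq_iSup : g.vol = ⨆ e, g.chartVol e := rfl

variable [BorelSpace X]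

theorem aemeasurable_symm (e : RigidChart n X) :
    AEMeasurable e.1.symm (((volume : Measure (Cn n)).restrict e.1.target).withDensity
      fun u => ENNReal.ofReal (g.coeff e u).det.re) :=
  (e.1.continuousOn_symm.aemeasurable e.1.open_target.measurableSet).mono_ac
    (withDensity_absolutelyContinuous _ _)

theorem chartVol_apply (e : RigidChart n X) {s : Set X} (hs : MeasurableSet s) :
    g.chartVol e s =
      ∫⁻ u in e.1.symm ⁻¹' s ∩ e.1.target, ENNReal.ofReal (g.coeff e u).det.re := by
  rw [chartVol, Measure.map_apply_of_aemeasurable (g.aemeasurable_symm e) hs,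
    withDensity_apply', Measure.restrict_restrict' e.1.open_target.measurableSet]

theorem measurableSet_preimage_symm (e : RigidChart n X) {s : Set X}
    (hs : MeasurableSet s) : MeasurableSet (e.1.symm ⁻¹' s ∩ e.1.target) := by
  have h : Measurable fun u : e.1.target => e.1.symm u :=
    (e.1.continuousOn_symm.comp_continuous continuous_subtype_val fun u => u.2).measurable
  have h2 := e.1.open_target.measurableSet.subtype_image (h hs)
  convert h2 using 1
  ext u
  simp [and_comm]

theorem chartVol_eq (e e' : RigidChart n X) {s : Set X} (hs : MeasurableSet s)
    (h : s ⊆ e.1.source) (h' : s ⊆ e'.1.source) : g.chartVol e s = g.chartVol e' s := by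
  rw [chartVol_apply g e hs, chartVol_apply g e' hs]
  have hsub : e.1.symm ⁻¹' s ∩ e.1.target ⊆ (transition e.1 e'.1).source := fun u hu =>
    mem_transition_source.2 ⟨hu.2, h' hu.1⟩
  have himg : e'.1.symm ⁻¹' s ∩ e'.1.target =
      transition e.1 e'.1 '' (e.1.symm ⁻¹' s ∩ e.1.target) := by
    ext w
    constructor
    · rintro ⟨hw, hw'⟩
      refine ⟨e.1 (e'.1.symm w), ⟨?_, e.1.map_source (h hw)⟩, ?_⟩
      · simpa [h hw] using hw
      · simp [h hw, hw']
    · rintro ⟨u, hu, rfl⟩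
      refine ⟨?_, e'.1.map_source (h' hu.1)⟩
      have := h' hu.1
      simpa [this] using hu.1
  rw [himg, lintegral_image_eq_lintegral_abs_det_fderiv_mul volume
    (measurableSet_preimage_symm e hs)
    (f' := fun u => fderiv ℝ (transition e.1 e'.1) u)
    (fun u hu => ((RigidChart.diagonalAt e e' (hsub hu)).1.differentiableAt
      (by simp)).hasFDerivAt.hasFDerivWithinAt)
    ((transition e.1 e'.1).injOn.mono hsub)]
  refine setLIntegral_congr_fun (measurableSet_preimage_symm e hs) fun u hu => ?_
  rw [g.det_coeff_transition e e' (hsub hu), ENNReal.ofReal_mul (abs_nonneg _)]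

theorem chartVol_compl (e : RigidChart n X) : g.chartVol e e.1.sourceᶜ = 0 := by
  rw [chartVol_apply g e e.1.open_source.measurableSet.compl]
  have : e.1.symm ⁻¹' e.1.sourceᶜ ∩ e.1.target = ∅ := by
    ext u
    simpa using fun h hu => h (e.1.map_target hu)
  rw [this, Measure.restrict_empty, lintegral_zero_measure]

theorem vol_apply (e : RigidChart n X) {s : Set X} (hs : MeasurableSet s) (h : s ⊆ e.1.source) :
    g.vol s = g.chartVol e s := by
  rw [vol_eq_iSup]
  refine le_antisymm ?_ (le_iSup g.chartVol e s)
  -- The infinite measure outside the chart dominates whatever other charts contribute there; inside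
  -- the chart, every chart measure is at most that of `e` by agreement on overlaps. Sets inside the
  -- source do not see the added term.
  have hle : ⨆ e, g.chartVol e ≤ g.chartVol e + (⊤ : Measure X).restrict e.1.sourceᶜ := by
    refine iSup_le fun e' => Measure.le_iff.2 fun t ht => ?_
    have hm := e.1.open_source.measurableSet
    rw [← measure_inter_add_sdiff t hm, Measure.add_apply]
    refine add_le_add ?_ ?_
    · rw [← measure_inter_add_sdiff (t ∩ e.1.source) e'.1.open_source.measurableSet]
      have h0 : g.chartVol e' ((t ∩ e.1.source) \ e'.1.source) = 0 :=
        measure_mono_null (fun x hx => hx.2) (g.chartVol_compl e')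
      rw [h0, add_zero, g.chartVol_eq e' e ((ht.inter hm).inter e'.1.open_source.measurableSet)
        (fun x hx => hx.2) (fun x hx => hx.1.2)]
      exact measure_mono fun x hx => hx.1.1
    · rw [Measure.restrict_apply ht, ← Set.sdiff_eq]
      exact (le_top : g.chartVol e' ≤ ⊤) _
  refine (hle s).trans ?_
  rw [Measure.add_apply, Measure.restrict_apply hs, Set.disjoint_iff_inter_eq_empty.1
    (Set.disjoint_compl_right_iff_subset.2 h), measure_empty, add_zero]

theorem vol_restrict (e : RigidChart n X) : g.vol.restrict e.1.source = g.chartVol e := by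
  ext s hs
  have hm := e.1.open_source.measurableSet
  have h0 : g.chartVol e (s \ e.1.source) = 0 :=
    measure_mono_null (fun x hx => hx.2) (g.chartVol_compl e)
  rw [Measure.restrict_apply hs, g.vol_apply e (hs.inter hm) Set.inter_subset_right,
    ← measure_inter_add_sdiff (μ := g.chartVol e) s hm, h0, add_zero]

/-- The integral of a function supported in the domain of a chart. -/
theorem integral_vol_eq (e : RigidChart n X) {F : X → ℂ} (hF : Continuous F)
    (h0 : ∀ x ∉ e.1.source, F x = 0) :
    ∫ x, F x ∂g.vol = ∫ u in e.1.target, ((g.coeff e u).det.re : ℂ) * F (e.1.symm u) := by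
  rw [← setIntegral_eq_integral_of_forall_compl_eq_zero h0, g.vol_restrict e, chartVol,
    integral_map (g.aemeasurable_symm e) hF.aestronglyMeasurable,
    integral_withDensity_eq_integral_toReal_smul₀ (g.aemeasurable_density e)
      (by simp)]
  refine setIntegral_congr_fun e.1.open_target.measurableSet fun u hu => ?_
  simp only [ENNReal.toReal_ofReal (g.det_coeff_pos e hu).le, Complex.real_smul]

variable [IsRigidified n X]

/-! ### Local finiteness and positivity on open sets of the volume. -/

theorem isLocallyFiniteMeasure_vol : IsLocallyFiniteMeasure g.vol := by
  refine ⟨fun x => ?_⟩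
  set e := rigidChartAt n x with he
  have hx : x ∈ e.1.source := mem_chart_source (Cn n) x
  obtain ⟨K, hK, hKsub, hKc⟩ := exists_compact_subset e.1.open_target (e.1.map_source hx)
  have hopen : IsOpen (e.1.source ∩ e.1 ⁻¹' interior K) :=
    e.1.isOpen_inter_preimage isOpen_interior
  refine ⟨_, hopen.mem_nhds ⟨hx, hKsub⟩, ?_⟩
  rw [g.vol_apply e hopen.measurableSet Set.inter_subset_left,
    chartVol_apply g e hopen.measurableSet]
  have hint : IntegrableOn (fun u => (g.coeff e u).det.re) K :=
    ((g.continuousOn_det_coeff e).mono hKc).integrableOn_compact hK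
  refine (lintegral_mono_set fun u hu => ?_).trans_lt hint.lintegral_lt_top
  have := hu.1.2
  simp only [Set.mem_preimage, e.1.right_inv hu.2] at this
  exact interior_subset this

theorem isOpenPosMeasure_vol : g.vol.IsOpenPosMeasure := by
  refine ⟨fun U hU hne h0 => ?_⟩
  obtain ⟨x, hxU⟩ := hne
  set e := rigidChartAt n x with he
  have hx : x ∈ e.1.source := mem_chart_source (Cn n) x
  have hm : MeasurableSet (U ∩ e.1.source) := (hU.inter e.1.open_source).measurableSet
  have h1 : g.vol (U ∩ e.1.source) = 0 := measure_mono_null Set.inter_subset_left h0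
  rw [g.vol_apply e hm Set.inter_subset_right, chartVol_apply g e hm] at h1
  set V := e.1.symm ⁻¹' (U ∩ e.1.source) ∩ e.1.target with hV
  have hVo : IsOpen V := by
    rw [hV, Set.inter_comm]
    exact e.1.symm.isOpen_inter_preimage (hU.inter e.1.open_source)
  have hVne : V.Nonempty := ⟨e.1 x, by simp [hx, hxU], e.1.map_source hx⟩
  have hd : AEMeasurable (fun u => ENNReal.ofReal (g.coeff e u).det.re) (volume.restrict V) :=
    (g.aemeasurable_density e).mono_measure (Measure.restrict_mono Set.inter_subset_right le_rfl)
  rw [lintegral_eq_zero_iff' hd, Filter.EventuallyEq, ae_restrict_iff' hVo.measurableSet] at h1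
  have h2 : volume V = 0 := by
    refine measure_mono_null (fun u hu => ?_) h1
    simp only [Set.mem_compl_iff, Set.mem_ofPred_eq, not_forall]
    exact ⟨hu, by simpa using g.det_coeff_pos e hu.2⟩
  exact hVo.measure_ne_zero volume hVne h2

end HermitianMetric

open scoped Manifold Topology

section Smooth

variable {n : ℕ} {X : Type*} [TopologicalSpace X] [ChartedSpace (Cn n) X]

/-! ### Smooth functions -/

/-- Makes rigid charts charts of the underlying real smooth manifold, so that bump functions and
partitions of unity can multiply forms. -/
theorem RigidChart.mem_maximalAtlas (e : RigidChart n X) :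
    e.1 ∈ IsManifold.maximalAtlas 𝓘(ℝ, Cn n) ∞ X := by
  rw [IsManifold.maximalAtlas, mem_maximalAtlas_iff]
  intro e' he'
  have h := e.2 e' he'
  have h1 : ContDiffOn ℝ ∞ (transition e.1 e') (transition e.1 e').source := fun u hu =>
    (h.1.diagonalAt (transition e.1 e').open_source hu).1.contDiffWithinAt
  have h2 : ContDiffOn ℝ ∞ (transition e' e.1) (transition e' e.1).source := fun u hu =>
    (h.2.diagonalAt (transition e' e.1).open_source hu).1.contDiffWithinAt
  have hs : ∀ a b : OpenPartialHomeomorph X (Cn n), (transition a b).target =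
      (transition b a).source := fun a b => by
    rw [← OpenPartialHomeomorph.symm_source, transition,
      OpenPartialHomeomorph.trans_symm_eq_symm_trans_symm, OpenPartialHomeomorph.symm_symm]
  constructor
  · rw [contDiffGroupoid, mem_groupoid_of_pregroupoid]
    simpa [contDiffPregroupoid] using ⟨h1, h2⟩
  · rw [contDiffGroupoid, mem_groupoid_of_pregroupoid]
    simpa [contDiffPregroupoid] using ⟨h2, h1⟩

theorem contDiffOn_comp_symm {χ : X → ℝ} (hχ : ContMDiff 𝓘(ℝ, Cn n) 𝓘(ℝ, ℝ) ∞ χ)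
    (e : RigidChart n X) : ContDiffOn ℝ ∞ (χ ∘ e.1.symm) e.1.target :=
  (hχ.comp_contMDiffOn (contMDiffOn_symm_of_mem_maximalAtlas e.mem_maximalAtlas)).contDiffOn

/-- The product of a smooth real function and a form. -/
def funSmul (χ : X → ℝ) (hχ : ContMDiff 𝓘(ℝ, Cn n) 𝓘(ℝ, ℝ) ∞ χ) {k : ℕ} (ψ : DiffForm n X k) :
    DiffForm n X k :=
  ofLocal (fun e u => (χ (e.1.symm u) : ℂ) • ψ.1 e u)
    (fun e => (Complex.ofRealCLM.contDiff.comp_contDiffOn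
      (contDiffOn_comp_symm hχ e)).smul (ψ.2.1 e))
    (fun e e' u hu => by
      rw [ψ.2.2.1 e e' u hu]
      have h : e'.1.symm (transition e.1 e'.1 u) = e.1.symm u := by
        simp [(mem_transition_source.1 hu).2]
      rw [h]
      rfl)

theorem funSmul_apply (χ : X → ℝ) (hχ : ContMDiff 𝓘(ℝ, Cn n) 𝓘(ℝ, ℝ) ∞ χ) {k : ℕ}
    (ψ : DiffForm n X k) {e : RigidChart n X} {u : Cn n} (hu : u ∈ e.1.target) :
    (funSmul χ hχ ψ).1 e u = (χ (e.1.symm u) : ℂ) • ψ.1 e u :=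
  ofLocal_apply _ _ _ hu

variable [IsRigidified n X]

theorem isManifold : IsManifold 𝓘(ℝ, Cn n) ∞ X := by
  refine isManifold_of_contDiffOn _ _ _ fun e e' he he' => ?_
  have h := (IsRigidified.compatible (n := n) e he e' he').1
  simp only [modelWithCornersSelf_coe, modelWithCornersSelf_coe_symm, Function.comp_id,
    Function.id_comp, Set.preimage_id, Set.range_id, Set.inter_univ]
  exact fun u hu => (h.diagonalAt (transition e e').open_source hu).1.contDiffWithinAt

/-! ### The support of a form -/

/-- The preferred chart may jump with the point, so `valueAt` need not be continuous; vanishing is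
independent of the chart, and supports can be computed in any chart. -/
theorem valueAt_eq_zero_iff {k : ℕ} (ψ : DiffForm n X k) (e : RigidChart n X) {x : X}
    (hx : x ∈ e.1.source) : valueAt ψ x = 0 ↔ ψ.1 e (e.1 x) = 0 := by
  have key : ∀ e e' : RigidChart n X, x ∈ e.1.source → x ∈ e'.1.source →
      ψ.1 e (e.1 x) = 0 → ψ.1 e' (e'.1 x) = 0 := fun e e' he he' h => by
    have hu : e'.1 x ∈ (transition e'.1 e.1).source :=
      mem_transition_source.2 ⟨e'.1.map_source he', by simpa [he'] using he⟩
    have ht : transition e'.1 e.1 (e'.1 x) = e.1 x := by simp [he']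
    rw [ψ.2.2.1 e' e _ hu, ht, h]
    rfl
  have hc : x ∈ (rigidChartAt n x).1.source := mem_chart_source (Cn n) x
  exact ⟨key _ _ hc hx, key _ _ hx hc⟩

theorem valueAt_funSmul (χ : X → ℝ) (hχ : ContMDiff 𝓘(ℝ, Cn n) 𝓘(ℝ, ℝ) ∞ χ) {k : ℕ}
    (ψ : DiffForm n X k) (x : X) : valueAt (funSmul χ hχ ψ) x = (χ x : ℂ) • valueAt ψ x := by
  have hc : x ∈ (rigidChartAt n x).1.source := mem_chart_source (Cn n) x
  rw [valueAt, funSmul_apply χ hχ ψ ((rigidChartAt n x).1.map_source hc),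
    (rigidChartAt n x).1.left_inv hc]
  rfl

theorem support_valueAt_xi_subset (j : Fin n) {k : ℕ} (ψ : DiffForm n X k) :
    Function.support (valueAt (xi X j k ψ)) ⊆ tsupport (valueAt ψ) := by
  intro x hx
  by_contra hxs
  refine hx ?_
  set e := rigidChartAt n x
  have hc : x ∈ e.1.source := mem_chart_source (Cn n) x
  have hu := e.1.map_source hc
  have h0 : ∀ᶠ y in 𝓝 x, valueAt ψ y = 0 := notMem_tsupport_iff_eventuallyEq.1 hxs
  have h1 : ψ.1 e =ᶠ[𝓝 (e.1 x)] fun _ => 0 := by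
    have h2 := (e.1.continuousAt_symm hu).eventually (by rw [e.1.left_inv hc]; exact h0)
    filter_upwards [h2, e.1.open_target.mem_nhds hu] with u hu hut
    rw [valueAt_eq_zero_iff ψ e (e.1.map_target hut), e.1.right_inv hut] at hu
    exact hu
  rw [valueAt_eq_zero_iff _ e hc, xi_apply j ψ hu, xiLocal_congr j h1, xiLocal_eq_wirtinger,
    wirtinger_eq_zero fun t => by simp, ← wedgeCLM_apply, map_zero]

/-! ### The inner product of forms on `X` -/

namespace HermitianMetric

/-- The pointwise inner product of two forms. -/
def pointInner (g : HermitianMetric n X) {k : ℕ} (ψ η : DiffForm n X k) (x : X) : ℂ :=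
  formInner (g.coeff (rigidChartAt n x) ((rigidChartAt n x).1 x)) (valueAt ψ x) (valueAt η x)

/-- Metric and forms change charts by the same diagonal map, so `formInner_pullback` applies. This
permits computing in a single chart near a point. -/
theorem pointInner_eq (g : HermitianMetric n X) {k : ℕ} (ψ η : DiffForm n X k)
    (e : RigidChart n X) {x : X} (hx : x ∈ e.1.source) :
    g.pointInner ψ η x =
      formInner (g.coeff e (e.1 x)) (ψ.1 e (e.1 x)) (η.1 e (e.1 x)) := by
  set c := rigidChartAt n x with hcdef
  have hc : x ∈ c.1.source := mem_chart_source (Cn n) x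
  have hu : c.1 x ∈ (transition c.1 e.1).source :=
    mem_transition_source.2 ⟨c.1.map_source hc, by simpa [hc] using hx⟩
  have ht : transition c.1 e.1 (c.1 x) = e.1 x := by simp [hc]
  obtain ⟨a, ha0, ha⟩ := c.exists_fderiv_transition e hu
  rw [pointInner, valueAt, valueAt, ← hcdef, ψ.2.2.1 c e _ hu, η.2.2.1 c e _ hu,
    g.coeff_transition c e hu ha, ha, formInner_pullback _ ha0, ht]

theorem IsDistinctiveKahler.continuous_pointInner {g : HermitianMetric n X}
    (hg : g.IsDistinctiveKahler) {k : ℕ} (ψ η : DiffForm n X k) :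
    Continuous (g.pointInner ψ η) := by
  refine continuous_iff_continuousAt.2 fun x => ?_
  obtain ⟨e, d, hx, h⟩ := hg.exists_isDiagonalIn x
  have hu := e.1.map_source hx
  have h1 : g.pointInner ψ η =ᶠ[𝓝 x] (fun u => (1 / (k.factorial : ℂ)) *
      ∑ a : Fin k → Fin n × Fin 2, (∏ i, (d (a i).1 (u (a i).1) : ℂ)⁻¹) *
        ψ.1 e u (fun i => realBasis (a i)) *
          (starRingEnd ℂ) (η.1 e u fun i => realBasis (a i))) ∘ e.1 := by
    filter_upwards [e.1.open_source.mem_nhds hx] with y hy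
    have hyt := e.1.map_source hy
    rw [g.pointInner_eq ψ η e hy, h.coeff_eq _ hyt,
      formInner_diagonal fun j => (h.pos hyt j).ne']
    rfl
  refine ContinuousAt.congr (ContinuousAt.comp ?_ (e.1.continuousAt hx)) h1.symm
  have heval : ∀ (ψ : DiffForm n X k) (v : Fin k → Cn n),
      ContinuousAt (fun u => ψ.1 e u v) (e.1 x) := fun ψ v =>
    (evalCLM v).continuous.continuousAt.comp (DiffForm.contDiffAt ψ hu).continuousAt
  refine continuousAt_const.mul (tendsto_finsetSum _ fun a _ => ?_)
  exact ((tendsto_finsetProd _ fun i _ => (h.contDiffAt_coord_inv hu _).continuousAt).mul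
    (heval ψ _)).mul (Complex.continuous_conj.continuousAt.comp (heval η _))

theorem support_pointInner_subset (g : HermitianMetric n X) {k : ℕ} (ψ η : DiffForm n X k) :
    Function.support (g.pointInner ψ η) ⊆ Function.support (valueAt η) := by
  intro x hx h
  rw [Function.mem_support, pointInner, h, formInner_zero_right] at hx
  exact hx rfl

theorem pointInner_add_left (g : HermitianMetric n X) {k : ℕ} (ψ ψ' η : DiffForm n X k) (x : X) :
    g.pointInner (ψ + ψ') η x = g.pointInner ψ η x + g.pointInner ψ' η x :=
  formInner_add_left _ _ _ _

theorem pointInner_smul_left (g : HermitianMetric n X) {k : ℕ} (c : ℂ) (ψ η : DiffForm n X k)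
    (x : X) : g.pointInner (c • ψ) η x = c * g.pointInner ψ η x :=
  formInner_smul_left _ _ _ _

theorem pointInner_add_right (g : HermitianMetric n X) {k : ℕ} (ψ η η' : DiffForm n X k) (x : X) :
    g.pointInner ψ (η + η') x = g.pointInner ψ η x + g.pointInner ψ η' x :=
  formInner_add_right _ _ _ _

variable [MeasurableSpace X]

theorem inner_eq_integral (g : HermitianMetric n X) {k : ℕ} (ψ η : DiffForm n X k) :
    g.inner ψ η = ∫ x, g.pointInner ψ η x ∂g.vol := rfl

theorem inner_smul_left (g : HermitianMetric n X) {k : ℕ} (c : ℂ) (ψ η : DiffForm n X k) :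
    g.inner (c • ψ) η = c * g.inner ψ η := by
  simp only [inner_eq_integral, pointInner_smul_left]
  exact integral_const_mul c _

variable [BorelSpace X] {g : HermitianMetric n X}

theorem IsDistinctiveKahler.integrable_pointInner (hg : g.IsDistinctiveKahler) {k : ℕ}
    (ψ : DiffForm n X k) {η : DiffForm n X k} (hη : HasCompactSupport (valueAt η)) :
    Integrable (g.pointInner ψ η) g.vol :=
  haveI := g.isLocallyFiniteMeasure_vol
  (hg.continuous_pointInner ψ η).integrable_of_hasCompactSupport
    (hη.mono (g.support_pointInner_subset ψ η))

theorem IsDistinctiveKahler.inner_add_right (hg : g.IsDistinctiveKahler) {k : ℕ}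
    (ψ : DiffForm n X k) {η η' : DiffForm n X k} (hη : HasCompactSupport (valueAt η))
    (hη' : HasCompactSupport (valueAt η')) :
    g.inner ψ (η + η') = g.inner ψ η + g.inner ψ η' := by
  simp only [inner_eq_integral, pointInner_add_right]
  exact integral_add (hg.integrable_pointInner ψ hη) (hg.integrable_pointInner ψ hη')

theorem IsDistinctiveKahler.inner_add_left (hg : g.IsDistinctiveKahler) {k : ℕ}
    (ψ ψ' : DiffForm n X k) {η : DiffForm n X k} (hη : HasCompactSupport (valueAt η)) :
    g.inner (ψ + ψ') η = g.inner ψ η + g.inner ψ' η := by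
  simp only [inner_eq_integral, pointInner_add_left]
  exact integral_add (hg.integrable_pointInner ψ hη) (hg.integrable_pointInner ψ' hη)

end HermitianMetric

end Smooth

/-! ### Formal adjoints -/

theorem integral_fderiv_eq_zero {n : ℕ} {G : Cn n → ℂ} (hG : ContDiff ℝ ∞ G)
    (hc : HasCompactSupport G) (v : Cn n) :
    Integrable (fun u => fderiv ℝ G u v) ∧ ∫ u, fderiv ℝ G u v = 0 := by
  have hcont : Continuous fun u => fderiv ℝ G u v :=
    (hG.continuous_fderiv (by simp)).clm_apply continuous_const
  have hint : Integrable fun u => fderiv ℝ G u v :=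
    hcont.integrable_of_hasCompactSupport (hc.fderiv_apply ℝ v)
  refine ⟨hint, ?_⟩
  -- Integration by parts against the constant function `1`.
  have h := integral_mul_fderiv_eq_neg_fderiv_mul_of_integrable (μ := volume)
    (f := fun _ => (1 : ℂ)) (g := G) (v := v) (by simp) (by simpa using hint)
    (by simpa using hG.continuous.integrable_of_hasCompactSupport hc)
    (fun _ _ => differentiableAt_const _)
    (fun x _ => hG.differentiable (by simp) x)
  simpa using h

theorem integral_wirtinger_eq_zero {n : ℕ} (s : ℂ) (j : Fin n) {G : Cn n → ℂ}
    (hG : ContDiff ℝ ∞ G) (hc : HasCompactSupport G) : ∫ u, wirtinger s j G u = 0 := by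
  have h0 := integral_fderiv_eq_zero hG hc (realBasis (j, 0))
  have h1 := integral_fderiv_eq_zero hG hc (realBasis (j, 1))
  simp only [wirtinger]
  have h2 : Integrable fun u => s • fderiv ℝ G u (realBasis (j, 1)) := h1.1.smul s
  rw [integral_smul, integral_add h0.1 h2, integral_smul, h0.2, h1.2]
  simp

section Adjoint

variable {n : ℕ} {X : Type*} [TopologicalSpace X] [ChartedSpace (Cn n) X] [IsRigidified n X]
  {g : HermitianMetric n X}

theorem flux_eq_zero {m : ℕ} (d : Fin n → ℂ → ℝ) (l : Fin n) (ψ : Cn n → Alt n (m + 1))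
    {η : Cn n → Alt n m} {u : Cn n} (h : η u = 0) : flux d l ψ η u = 0 := by
  simp [flux, h]

theorem exists_compact_support {k : ℕ} (e : RigidChart n X) {η : DiffForm n X k}
    (hη : HasCompactSupport (valueAt η)) (hs : tsupport (valueAt η) ⊆ e.1.source) :
    ∃ K, IsCompact K ∧ K ⊆ e.1.target ∧ ∀ u ∉ K, η.1 e u = 0 := by
  refine ⟨e.1 '' tsupport (valueAt η), hη.image_of_continuousOn (e.1.continuousOn.mono hs),
    ?_, fun u hu => ?_⟩
  · rintro _ ⟨x, hx, rfl⟩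
    exact e.1.map_source (hs hx)
  · by_cases hut : u ∈ e.1.target
    · have hx := e.1.map_target hut
      have h0 : valueAt η (e.1.symm u) = 0 := by
        by_contra h
        exact hu ⟨e.1.symm u, subset_tsupport _ h, e.1.right_inv hut⟩
      rw [valueAt_eq_zero_iff η e hx, e.1.right_inv hut] at h0
      exact h0
    · exact η.2.2.2 e u hut

theorem hasCompactSupport_xi (j : Fin n) {k : ℕ} {η : DiffForm n X k}
    (hη : HasCompactSupport (valueAt η)) : HasCompactSupport (valueAt (xi X j k η)) :=
  hη.mono' (support_valueAt_xi_subset j η)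

theorem hasCompactSupport_funSmul (χ : X → ℝ) (hχ : ContMDiff 𝓘(ℝ, Cn n) 𝓘(ℝ, ℝ) ∞ χ) {k : ℕ}
    {ψ : DiffForm n X k} (hψ : HasCompactSupport (valueAt ψ)) :
    HasCompactSupport (valueAt (funSmul χ hχ ψ)) :=
  hψ.mono fun x hx h => hx (by rw [valueAt_funSmul, h]; exact smul_zero (A := Alt n k) _)

theorem support_valueAt_funSmul_subset (χ : X → ℝ) (hχ : ContMDiff 𝓘(ℝ, Cn n) 𝓘(ℝ, ℝ) ∞ χ)
    {k : ℕ} (ψ : DiffForm n X k) :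
    Function.support (valueAt (funSmul χ hχ ψ)) ⊆ Function.support χ :=
  fun x hx h => hx (by rw [valueAt_funSmul, h, Complex.ofReal_zero]; exact zero_smul ℂ _)

variable [MeasurableSpace X] [BorelSpace X]

/-- The formal adjoint property for forms supported in a chart in which the metric is diagonal. -/
theorem HermitianMetric.IsDiagonalIn.inner_adj (hg : g.IsDistinctiveKahler) {e : RigidChart n X}
    {d : Fin n → ℂ → ℝ} (h : g.IsDiagonalIn e d) (l : Fin n) {m : ℕ} (ψ : DiffForm n X (m + 1))
    {η : DiffForm n X m} (hη : HasCompactSupport (valueAt η))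
    (hs : tsupport (valueAt η) ⊆ e.1.source) :
    g.inner (g.adj l m ψ) η = g.inner ψ (xi X l m η) := by
  obtain ⟨K, hK, hKt, hK0⟩ := exists_compact_support e hη hs
  have hflux0 : ∀ u ∉ K, flux d l (ψ.1 e) (η.1 e) =ᶠ[𝓝 u] fun _ => 0 := fun u hu => by
    filter_upwards [hK.isClosed.isOpen_compl.mem_nhds hu] with w hw
      using flux_eq_zero d l _ (hK0 w hw)
  have hfs : HasCompactSupport (flux d l (ψ.1 e) (η.1 e)) :=
    HasCompactSupport.intro hK fun u hu => (hflux0 u hu).self_of_nhds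
  -- Since `η` vanishes off the compact `K` inside the chart, the flux extends smoothly by zero to
  -- all of `ℂⁿ`, and its derivative has integral zero.
  have hfd : ContDiff ℝ ∞ (flux d l (ψ.1 e) (η.1 e)) := contDiff_iff_contDiffAt.2 fun u => by
    by_cases hu : u ∈ e.1.target
    · exact h.contDiffAt_flux hu l ψ η
    · exact contDiffAt_const.congr_of_eventuallyEq (hflux0 u fun hk => hu (hKt hk))
  have hzero : ∀ x ∉ e.1.source,
      g.pointInner ψ (xi X l m η) x - g.pointInner (g.adj l m ψ) η x = 0 := fun x hx => by
    have hx' : x ∉ tsupport (valueAt η) := fun hx' => hx (hs hx')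
    have h1 : g.pointInner ψ (xi X l m η) x = 0 := by
      by_contra h1
      exact hx' (support_valueAt_xi_subset l η (g.support_pointInner_subset _ _ h1))
    have h2 : g.pointInner (g.adj l m ψ) η x = 0 := by
      by_contra h2
      exact hx' (subset_tsupport _ (g.support_pointInner_subset _ _ h2))
    rw [h1, h2, sub_zero]
  refine (sub_eq_zero.1 ?_).symm
  rw [HermitianMetric.inner_eq_integral, HermitianMetric.inner_eq_integral,
    ← integral_sub (hg.integrable_pointInner ψ (hasCompactSupport_xi l hη))
      (hg.integrable_pointInner _ hη),
    g.integral_vol_eq e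
      (F := fun x => g.pointInner ψ (xi X l m η) x - g.pointInner (g.adj l m ψ) η x)
      ((hg.continuous_pointInner _ _).sub (hg.continuous_pointInner _ _)) hzero,
    ← integral_wirtinger_eq_zero Complex.I l hfd hfs,
    ← setIntegral_eq_integral_of_forall_compl_eq_zero (s := e.1.target)
      (f := wirtinger Complex.I l (flux d l (ψ.1 e) (η.1 e)))]
  · refine setIntegral_congr_fun e.1.open_target.measurableSet fun u hu => ?_
    have hx := e.1.map_target hu
    have hdet : ((g.coeff e u).det.re : ℂ) = (g.coeff e u).det := by
      rw [h.coeff_eq u hu, Matrix.det_diagonal, ← Complex.ofReal_prod, Complex.ofReal_re]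
    simp only [h.wirtinger_flux hu, g.pointInner_eq _ _ e hx, e.1.right_inv hu, hdet, mul_sub]
  · intro u hu
    rw [wirtinger_congr _ _ (hflux0 u fun hk => hu (hKt hk))]
    exact wirtinger_eq_zero fun t => by simp

variable [T2Space X]

/-- Only the test form `η` is cut into pieces supported in diagonal charts. Its support is compact,
so finitely many pieces suffice, and both sides are additive in `η`. -/
theorem HermitianMetric.IsDistinctiveKahler.isFormalAdjoint_adj [SecondCountableTopology X]
    (hg : g.IsDistinctiveKahler) (l : Fin n) (m : ℕ) :
    g.IsFormalAdjoint (xi X l m) (g.adj l m) := by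
  intro ψ η hη
  have : IsManifold 𝓘(ℝ, Cn n) ∞ X := isManifold
  have : LocallyCompactSpace X := ChartedSpace.locallyCompactSpace (Cn n) X
  choose e d hx h using hg.exists_isDiagonalIn
  obtain ⟨ρ, hρ⟩ := SmoothPartitionOfUnity.exists_isSubordinate 𝓘(ℝ, Cn n)
    (isClosed_tsupport (valueAt η)) (fun x : X => (e x).1.source)
    (fun x => (e x).1.open_source) (fun x _ => Set.mem_iUnion.2 ⟨x, hx x⟩)
  have hfin : {i | (Function.support (ρ i) ∩ tsupport (valueAt η)).Nonempty}.Finite :=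
    ρ.locallyFinite.finite_nonempty_inter_compact hη
  set F := hfin.toFinset with hF
  have hsum : η = ∑ i ∈ F, funSmul (ρ i) (ρ i).contMDiff η := by
    refine DiffForm.ext_target fun e u hu => ?_
    rw [Submodule.coe_sum, Finset.sum_apply, Finset.sum_apply]
    simp only [funSmul_apply _ _ η hu]
    rw [← Finset.sum_smul, ← Complex.ofReal_sum]
    by_cases hs : e.1.symm u ∈ tsupport (valueAt η)
    · have h1 : ∑ i ∈ F, ρ i (e.1.symm u) = 1 := by
        rw [← ρ.sum_eq_one hs]
        refine (finsum_eq_sum_of_support_subset _ fun i hi => ?_).symm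
        rw [hF, Set.Finite.coe_toFinset]
        exact ⟨_, hi, hs⟩
      rw [h1, Complex.ofReal_one, one_smul]
    · have h0 : valueAt η (e.1.symm u) = 0 := by
        by_contra h0
        exact hs (subset_tsupport _ h0)
      rw [valueAt_eq_zero_iff η e (e.1.map_target hu), e.1.right_inv hu] at h0
      rw [h0]
      exact (smul_zero (A := Alt n m) _).symm
  have hmain : HasCompactSupport (valueAt (∑ i ∈ F, funSmul (ρ i) (ρ i).contMDiff η)) ∧
      g.inner (g.adj l m ψ) (∑ i ∈ F, funSmul (ρ i) (ρ i).contMDiff η) =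
        g.inner ψ (xi X l m (∑ i ∈ F, funSmul (ρ i) (ρ i).contMDiff η)) := by
    -- Compact support is carried through the induction because additivity of the integrals needs
    -- integrability.
    refine Finset.sum_induction (fun i => funSmul (ρ i) (ρ i).contMDiff η)
      (fun η => HasCompactSupport (valueAt η) ∧
        g.inner (g.adj l m ψ) η = g.inner ψ (xi X l m η)) ?_ ?_ ?_
    · rintro η η' ⟨h1, h2⟩ ⟨h1', h2'⟩
      refine ⟨h1.add h1', ?_⟩
      rw [hg.inner_add_right _ h1 h1', h2, h2', map_add,
        hg.inner_add_right _ (hasCompactSupport_xi l h1) (hasCompactSupport_xi l h1')]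
    · refine ⟨HasCompactSupport.zero, ?_⟩
      have h0 : ∀ {k : ℕ} (ψ : DiffForm n X k), g.inner ψ 0 = 0 := fun ψ => by
        have h1 : ∀ x, g.pointInner ψ 0 x = 0 := fun x => formInner_zero_right _ _
        simp [HermitianMetric.inner_eq_integral, h1]
      rw [map_zero, h0, h0]
    · intro i _
      have hc := hasCompactSupport_funSmul (ρ i) (ρ i).contMDiff hη
      refine ⟨hc, (h i).inner_adj hg l ψ hc ?_⟩
      exact (closure_mono (support_valueAt_funSmul_subset _ _ η)).trans (hρ i)
  rw [hsum]
  exact hmain.2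

/-- A form which is orthogonal to all compactly supported forms vanishes. -/
theorem HermitianMetric.IsDistinctiveKahler.eq_zero_of_inner (hg : g.IsDistinctiveKahler) {k : ℕ}
    {α : DiffForm n X k} (hα : ∀ η : DiffForm n X k, HasCompactSupport (valueAt η) →
      g.inner α η = 0) : α = 0 := by
  have : IsManifold 𝓘(ℝ, Cn n) ∞ X := isManifold
  have : LocallyCompactSpace X := ChartedSpace.locallyCompactSpace (Cn n) X
  have := g.isLocallyFiniteMeasure_vol
  have := g.isOpenPosMeasure_vol
  refine DiffForm.ext_chart fun x => ?_
  obtain ⟨e, d, hx, h⟩ := hg.exists_isDiagonalIn x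
  refine ⟨e, hx, ?_⟩
  obtain ⟨f⟩ : Nonempty (SmoothBumpFunction 𝓘(ℝ, Cn n) x) := inferInstance
  have hfs : HasCompactSupport f := f.hasCompactSupport
  -- Test `α` against `f α`: the density `f (α, α)` is continuous, nonnegative and of zero integral,
  -- hence zero at `x`, where `f = 1`.
  set η := funSmul f f.contMDiff α with hη
  have hηs : HasCompactSupport (valueAt η) :=
    hfs.mono (support_valueAt_funSmul_subset _ _ α)
  have hP : ∀ y, g.pointInner α η y = (f y : ℂ) * g.pointInner α α y := fun y => by
    rw [HermitianMetric.pointInner, hη, valueAt_funSmul, formInner_smul_right,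
      Complex.conj_ofReal]
    rfl
  have hnn : ∀ y, 0 ≤ (g.pointInner α η y).re := fun y => by
    obtain ⟨e, d, hy, h⟩ := hg.exists_isDiagonalIn y
    have hyt := e.1.map_source hy
    rw [hP, Complex.re_ofReal_mul, g.pointInner_eq α α e hy, h.coeff_eq _ hyt]
    exact mul_nonneg f.nonneg (formInner_self_nonneg (h.pos hyt) _)
  have hint := hg.integrable_pointInner α hηs
  have h0 : ∫ y, (g.pointInner α η y).re ∂g.vol = 0 := by
    have := hα η hηs
    rw [HermitianMetric.inner_eq_integral] at this
    exact (integral_re hint).trans (by rw [this]; rfl)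
  have hcont : Continuous fun y => (g.pointInner α η y).re :=
    Complex.continuous_re.comp (hg.continuous_pointInner α η)
  have hcs : HasCompactSupport fun y => (g.pointInner α η y).re :=
    hηs.mono fun y hy => g.support_pointInner_subset α η fun h => hy (by simp [h])
  have hx0 : (g.pointInner α η x).re = 0 := by
    by_contra hne
    exact (hcont.integral_pos_of_hasCompactSupport_nonneg_nonzero (μ := g.vol) hcs hnn hne).ne' h0
  have hxt := e.1.map_source hx
  rw [hP, f.eq_one, Complex.ofReal_one, one_mul, g.pointInner_eq α α e hx,
    h.coeff_eq _ hxt] at hx0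
  exact eq_zero_of_formInner_self (h.pos hxt) hx0

theorem HermitianMetric.IsDistinctiveKahler.isFormalAdjoint_unique (hg : g.IsDistinctiveKahler)
    {k l : ℕ} {D : DiffForm n X k →ₗ[ℂ] DiffForm n X l} {P P' : DiffForm n X l →ₗ[ℂ] DiffForm n X k}
    (hP : g.IsFormalAdjoint D P) (hP' : g.IsFormalAdjoint D P') : P = P' := by
  refine LinearMap.ext fun ψ => ?_
  have h0 : P ψ + (-1 : ℂ) • P' ψ = 0 := hg.eq_zero_of_inner fun η hη => by
    rw [hg.inner_add_left _ _ hη, g.inner_smul_left, hP ψ η hη, hP' ψ η hη]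
    ring
  calc P ψ = (P ψ + (-1 : ℂ) • P' ψ) + P' ψ := by module
    _ = P' ψ := by rw [h0, zero_add]

end Adjoint

end RigidKahler

end

/-! ### Existence, uniqueness and anticommutation of the adjoints. -/

open RigidKahler

theorem mainTheorem7 {n : ℕ} {X : Type*} [TopologicalSpace X] [T2Space X]
    [SecondCountableTopology X] [ChartedSpace (Cn n) X] [IsRigidified n X]
    [MeasurableSpace X] [BorelSpace X]
    (g : HermitianMetric n X) (hg : g.IsDistinctiveKahler) :
    -- every `ξ_k` has a unique formal adjoint in every degree
    (∀ (k : Fin n) (m : ℕ), ∃! P : DiffForm n X (m + 1) →ₗ[ℂ] DiffForm n X m,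
      g.IsFormalAdjoint (xi X k m) P) ∧
    -- and the formal adjoints `ξ_k^*` satisfy `ξ_j ξ_k^* + ξ_k^* ξ_j = 0` for `j ≠ k`,
    -- on functions (where `ξ_k^*` vanishes) and on forms of positive degree
    ∀ xiStar : Fin n → (m : ℕ) → DiffForm n X (m + 1) →ₗ[ℂ] DiffForm n X m,
      (∀ k m, g.IsFormalAdjoint (xi X k m) (xiStar k m)) →
      ∀ j k : Fin n, j ≠ k →
        (xiStar k 0 ∘ₗ xi X j 0 = 0) ∧
        ∀ m : ℕ, xi X j m ∘ₗ xiStar k m + xiStar k (m + 1) ∘ₗ xi X j (m + 1) = 0 := by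
  refine ⟨fun k m => ⟨g.adj k m, hg.isFormalAdjoint_adj k m, fun P hP =>
    hg.isFormalAdjoint_unique hP (hg.isFormalAdjoint_adj k m)⟩, fun xiStar hxi j k hjk => ?_⟩
  -- By uniqueness an arbitrary family of adjoints is the explicit one, for which the relations are
  -- already known.
  have h : ∀ m, xiStar k m = g.adj k m := fun m =>
    hg.isFormalAdjoint_unique (hxi k m) (hg.isFormalAdjoint_adj k m)
  exact ⟨by rw [h]; exact g.adj_zero_comp_xi hjk,
    fun m => by rw [h, h]; exact hg.xi_adj_add_adj_xi hjk m⟩
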